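/- Let $n\ge 0$ be an even integer and let $S^2\subset\mathbb{R}^3$ be the unit sphere. A noncrossing matching $a$ on the vertices $1,\dots,n$ is a set of arcs $(i,j)$ with $i<j$ such that every vertex is an endpoint of exactly one arc and there are no two arcs $(i,j),(k,l)\in a$ with $i<k<j<l$. Put $$S_a=\{(x_1,\dots,x_n)\in (S^2)^n : x_i=x_j \text{ whenever } (i,j)\in a\},\qquad X_n=\bigcup_a S_a\subseteq (S^2)^n,$$ where the union is over all noncrossing matchings $a$ on $n$ vertices (this is Khovanov's construction of the $(n/2,n/2)$ Springer variety). Define $\gamma: X_n\to (S^2)^n$ by $\gamma(x_1,\dots,x_n)=((-1)^i x_i)_i=(-x_1,x_2,\dots,-x_{n-1},x_n)$. For each $a$ define $\gamma_a:S_a\to (S^2)^n$ by negating the coordinates $x_i$ for which $i$ is the left endpoint of an arc of $a$ and leaving the other coordinates unchanged. Let $H_*=\bigoplus_k H_k$ denote singular homology with complex coefficients. Then (1) $\gamma_*(H_*(X_n))$ is the vector subspace of $H_*((S^2)^n)$ spanned by $\bigcup_a (\gamma_a)_*(H_*(S_a))$. (2) On product generators of $H_*(S_a)$ the maps $(\gamma|_{S_a})_*$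 and $(\gamma_a)_*$ agree up to sign. More precisely, fix a point $p\in S^2$, let $a$ be a noncrossing matching and $D\subseteq a$ a set of arcs (the dotted arcs), and let $k$ be the number of arcs of $a$ not in $D$. Let $C_{a,D}=\{x\in S_a : x_i=x_j=p \text{ for all } (i,j)\in D\}\cong (S^2)^k$, the closure of a cell in the product cell structure of $S_a\cong (S^2)^{n/2}$. Then there is a sign $\varepsilon\in\{1,-1\}$ such that $(\gamma|_{S_a})_*(q)=\varepsilon\,(\gamma_a)_*(q)$ for every $q$ in the image of $H_{2k}(C_{a,D})\to H_{2k}(S_a)$, the line spanned by the generator of $H_*(S_a)$ corresponding to $(a,D)$. -/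

import Mathlib

open CategoryTheory

noncomputable section

/-- The `k`-th singular homology of `X` with complex coefficients. -/
abbrev HomologyC (k : ℕ) (X : Type) [TopologicalSpace X] : ModuleCat.{0} ℂ :=
  ((AlgebraicTopology.singularHomologyFunctor (ModuleCat.{0} ℂ) k).obj
    (ModuleCat.of ℂ ℂ)).obj (TopCat.of X)

/-- The map induced by a continuous map on the `k`-th singular homology. -/
def homologyCMap (k : ℕ) {X Y : Type} [TopologicalSpace X] [TopologicalSpace Y] (f : C(X, Y)) :
    HomologyC k X →ₗ[ℂ] HomologyC k Y :=
  (((AlgebraicTopology.singularHomologyFunctor (ModuleCat.{0} ℂ) k).obj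
    (ModuleCat.of ℂ ℂ)).map (TopCat.ofHom f)).hom

/-- The total homology `H_*(X) = ⨁ₖ H_k(X)`, with complex coefficients. -/
abbrev TotalHomologyC (X : Type) [TopologicalSpace X] : Type :=
  DirectSum ℕ fun k => HomologyC k X

/-- The map `f_* : H_*(X) → H_*(Y)` induced by a continuous map `f`. -/
def totalHomologyCMap {X Y : Type} [TopologicalSpace X] [TopologicalSpace Y] (f : C(X, Y)) :
    TotalHomologyC X →ₗ[ℂ] TotalHomologyC Y :=
  DirectSum.lmap fun k => homologyCMap k f

/-- The unit sphere `S²` in `ℝ³`. -/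
abbrev S2 : Type := Metric.sphere (0 : EuclideanSpace ℝ (Fin 3)) 1

/-- A noncrossing matching on `n` vertices. The vertex of the mathematical set `{1, …, n}` called
`i + 1` is the element `i` of `Fin n`. An arc is recorded as the pair (left endpoint, right
endpoint). -/
structure NoncrossingMatching (n : ℕ) where
  arcs : Finset (Fin n × Fin n)
  left_lt_right : ∀ e ∈ arcs, e.1 < e.2
  perfect : ∀ i : Fin n, ∃! e : Fin n × Fin n, e ∈ arcs ∧ (e.1 = i ∨ e.2 = i)
  noncrossing : ∀ e ∈ arcs, ∀ e' ∈ arcs, ¬ (e.1 < e'.1 ∧ e'.1 < e.2 ∧ e.2 < e'.2)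

/-- The component `S_a = {x ∈ (S²)ⁿ : x_i = x_j if (i, j) ∈ a}`. -/
def component {n : ℕ} (a : NoncrossingMatching n) : Set (Fin n → S2) :=
  {x | ∀ e ∈ a.arcs, x e.1 = x e.2}

/-- Khovanov's construction of the `(n/2, n/2)` Springer variety: the union of all `S_a`. -/
def springerVariety (n : ℕ) : Set (Fin n → S2) :=
  ⋃ a : NoncrossingMatching n, component a

theorem component_subset_springerVariety {n : ℕ} (a : NoncrossingMatching n) :
    component a ⊆ springerVariety n :=
  Set.subset_iUnion (fun b : NoncrossingMatching n => component b) a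

/-- The map `(S²)ⁿ → (S²)ⁿ` that applies the antipodal map to the coordinates in `s` and the
identity to the others. -/
def negOn {n : ℕ} (s : Set (Fin n)) [DecidablePred (· ∈ s)] : C(Fin n → S2, Fin n → S2) where
  toFun x i := if i ∈ s then -x i else x i
  continuous_toFun := by
    refine continuous_pi fun i => ?_
    by_cases h : i ∈ s
    · simp only [h, if_true]
      fun_prop
    · simp only [h, if_false]
      fun_prop

open Classical in
/-- The antipodal embedding `γ : X_n → (S²)ⁿ`,
`γ(x_1, …, x_n) = (-x_1, x_2, -x_3, …, -x_{n-1}, x_n)`. -/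
def gammaMap (n : ℕ) : C(springerVariety n, Fin n → S2) :=
  (negOn {i : Fin n | Odd ((i : ℕ) + 1)}).comp ⟨Subtype.val, continuous_subtype_val⟩

open Classical in
/-- The embedding `γ_a : S_a → (S²)ⁿ`, which is the antipodal map on the coordinates that are left
endpoints of arcs of `a` and the identity on the right endpoints. -/
def gammaComponent {n : ℕ} (a : NoncrossingMatching n) : C(component a, Fin n → S2) :=
  (negOn {i : Fin n | ∃ j : Fin n, (i, j) ∈ a.arcs}).comp ⟨Subtype.val, continuous_subtype_val⟩

/-- The restriction `γ|_{S_a} : S_a → (S²)ⁿ`. -/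
def gammaRestrict {n : ℕ} (a : NoncrossingMatching n) : C(component a, Fin n → S2) :=
  (gammaMap n).comp ⟨Set.inclusion (component_subset_springerVariety a),
    continuous_inclusion (component_subset_springerVariety a)⟩

/-- The sphere `S²` has the cell structure with one point `p` and one two-cell, and
`S_a ≅ (S²)^{n/2}`, with one factor for each arc, has the product cell structure. Its cells
correspond to the sets `D` of dotted arcs of `a`: the factor of a dotted arc contributes the point,
the factor of an undotted arc the two-cell. This is the closure in `S_a` of the cell of `D`. -/
def closedCell {n : ℕ} (p : S2) (a : NoncrossingMatching n) (D : Finset (Fin n × Fin n)) :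
    Set (component a) :=
  {x | ∀ e ∈ D, x.1 e.1 = p ∧ x.1 e.2 = p}

/-- The line in the homology of `S_a` spanned by the product generator of the dotted matching
`(a, D)`: if there are `k` undotted arcs, the closed cell is a product of `k` spheres, and its
fundamental class spans `H_{2k}` of the closed cell; its image in `H_{2k}(S_a)` is the generator. -/
def generatorLine {n : ℕ} (p : S2) (a : NoncrossingMatching n) (D : Finset (Fin n × Fin n)) :
    Submodule ℂ (TotalHomologyC (component a)) :=
  let k := (a.arcs \ D).card
  (LinearMap.range (homologyCMap (2 * k)
      (⟨Subtype.val, continuous_subtype_val⟩ : C(closedCell p a D, component a)))).map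
    (DirectSum.lof ℂ ℕ (fun k => HomologyC k (component a)) (2 * k))

end

/-! The map γ is the restriction to X_n of a self-map of (S²)ⁿ that negates some coordinates, so γ_*
factors through H_*(X_n) → H_*((S²)ⁿ). The vertices strictly inside an arc are matched among
themselves, so the ends of an arc have opposite parity (`even_iff_of_mem`), and γ agrees with γ_a at
both ends or at neither. Hence γ|S_a = γ_a ∘ `flip`, where `flip` is an involution of S_a that
negates the factors of some arcs.

For (1) it remains to see that the image of H_*(X_n) in H_*((S²)ⁿ) lies in the sum of the images of
the H_*(S_a) (`map_valMap_springerVariety_mem`). Order the matchings lexicographically by their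
words of left and right endpoints and attach the S_b in increasing order. Then S_b meets the union
of the earlier components exactly where x_t = x_i for some arc starting at t whose innermost
enclosing arc starts at i (`exists_parent_eq`, `exists_lt_of_isParent`). These diagonals form a
forest, so the homology of a neighbourhood of their union injects into that of (S²)ⁿ
(`homologyCMap_valMap_nearSet_injective`). A Mayer–Vietoris boundary dies near S_b, hence in (S²)ⁿ,
hence near the intersection; so each class splits into one from the earlier components and one from
S_b. The argument runs in open neighbourhoods, with homotopies that slide points along great
circles. X_n is only contained in the last neighbourhood; no retraction to X_n is needed.

For (2), on the closed cell C ≅ (S²)^k the flip is homotopic inside S_a to an involution of C: move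
p to -p on the dotted flipped arcs. Since H_{2k}((S²)^k) has dimension at most one
(`homologyDependent_sphere_pow`), the involution acts by a scalar of square one. Only the upper
bound on the dimension matters.

Both parts use Mayer–Vietoris, proved by barycentric subdivision. It is phrased as the relation
`MVRel` between a class and its boundary, so no connecting homomorphism has to be well defined. -/

noncomputable section

/-! ### Concrete singular chains and the classes they represent -/

/-- The singular chain complex of `X` with complex coefficients. -/
abbrev singularComplexC (X : Type) [TopologicalSpace X] : ChainComplex (ModuleCat.{0} ℂ) ℕ :=
  ((AlgebraicTopology.singularChainComplexFunctor (ModuleCat.{0} ℂ)).obj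
    (ModuleCat.of ℂ ℂ)).obj (TopCat.of X)

/-- Singular chains as finitely supported functions on singular simplices. -/
abbrev SingChain (m : ℕ) (X : Type) [TopologicalSpace X] : Type :=
  C(stdSimplex ℝ (Fin (m + 1)), X) →₀ ℂ

/-- The inclusion of the `i`-th face. -/
def faceMap (m : ℕ) (i : Fin (m + 2)) :
    C(stdSimplex ℝ (Fin (m + 1)), stdSimplex ℝ (Fin (m + 2))) :=
  ⟨stdSimplex.map i.succAbove, stdSimplex.continuous_map _⟩

/-- The boundary operator on singular chains. -/
def singBoundary (m : ℕ) (X : Type) [TopologicalSpace X] :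
    SingChain (m + 1) X →ₗ[ℂ] SingChain m X :=
  Finsupp.linearCombination ℂ fun σ =>
    ∑ i : Fin (m + 2), (-1 : ℂ) ^ (i : ℕ) • Finsupp.single (σ.comp (faceMap m i)) 1

/-- The map induced on singular chains. -/
def singPush (m : ℕ) {X Y : Type} [TopologicalSpace X] [TopologicalSpace Y] (f : C(X, Y)) :
    SingChain m X →ₗ[ℂ] SingChain m Y :=
  Finsupp.lmapDomain ℂ ℂ fun σ => f.comp σ

open Simplicial in
/-- The simplex of the singular simplicial set given by a continuous map. -/
def singSimplex {m : ℕ} {X : Type} [TopologicalSpace X] (σ : C(stdSimplex ℝ (Fin (m + 1)), X)) :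
    (TopCat.toSSet.obj (TopCat.of X)) _⦋m⦌ :=
  (TopCat.toSSetObjEquiv (TopCat.of X) (Opposite.op ⦋m⦌)).symm σ

open Simplicial in
/-- The chains of the singular chain complex are the finitely supported functions. -/
def singChainIso (m : ℕ) (X : Type) [TopologicalSpace X] :
    (singularComplexC X).X m ≅ ModuleCat.of ℂ (SingChain m X) :=
  ((SSet.isColimitChainComplexXCofan (TopCat.toSSet.obj (TopCat.of X))
    (ModuleCat.of ℂ ℂ) m).coconePointUniqueUpToIso
    (ModuleCat.finsuppCoconeIsColimit ℂ ℂ ((TopCat.toSSet.obj (TopCat.of X)) _⦋m⦌))) ≪≫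
    (Finsupp.domLCongr (TopCat.toSSetObjEquiv (TopCat.of X) (Opposite.op ⦋m⦌))).toModuleIso

/-- The identification of concrete singular chains with those of the singular chain complex. -/
def singChainEquiv (m : ℕ) (X : Type) [TopologicalSpace X] :
    SingChain m X ≃ₗ[ℂ] (singularComplexC X).X m :=
  (singChainIso m X).symm.toLinearEquiv

open Limits in
-- Both models are coproducts of copies of ℂ indexed by the singular simplices, and the isomorphism
-- of colimit cocones matches their legs.
theorem singChainEquiv_single (m : ℕ) (X : Type) [TopologicalSpace X]
    (σ : C(stdSimplex ℝ (Fin (m + 1)), X)) (c : ℂ) :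
    singChainEquiv m X (Finsupp.single σ c) =
      (SSet.ιChainComplex (TopCat.toSSet.obj (TopCat.of X)) (R := ModuleCat.of ℂ ℂ)
        (singSimplex σ)).hom c := by
  apply (singChainEquiv m X).symm.injective
  rw [LinearEquiv.symm_apply_apply]
  have h := IsColimit.comp_coconePointUniqueUpToIso_hom
    (SSet.isColimitChainComplexXCofan (TopCat.toSSet.obj (TopCat.of X)) (ModuleCat.of ℂ ℂ) m)
    (ModuleCat.finsuppCoconeIsColimit ℂ ℂ
      ((TopCat.toSSet.obj (TopCat.of X)).obj (Opposite.op (SimplexCategory.mk m))))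
    ⟨singSimplex σ⟩
  have h' := congrArg (fun f => (ModuleCat.Hom.hom f) c) h
  have h'' := congrArg (Finsupp.domLCongr (R := ℂ) (M := ℂ)
    (TopCat.toSSetObjEquiv (TopCat.of X) (Opposite.op (SimplexCategory.mk m)))) h'
  refine Eq.trans ?_ h''.symm
  refine Eq.trans ?_ (Finsupp.domLCongr_single _ _ _).symm
  congr 1

theorem singSimplex_face {m : ℕ} {X : Type} [TopologicalSpace X]
    (σ : C(stdSimplex ℝ (Fin (m + 2)), X)) (i : Fin (m + 2)) :
    (TopCat.toSSet.obj (TopCat.of X)).δ i (singSimplex σ) = singSimplex (σ.comp (faceMap m i)) :=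
  rfl

theorem singSimplex_push {m : ℕ} {X Y : Type} [TopologicalSpace X] [TopologicalSpace Y]
    (f : C(X, Y)) (σ : C(stdSimplex ℝ (Fin (m + 1)), X)) :
    (TopCat.toSSet.map (TopCat.ofHom f)).app _ (singSimplex σ) = singSimplex (f.comp σ) :=
  rfl

/-- Reconciles the integer signs of the abstract differential with the complex signs of
`singBoundary`. -/
theorem smul_sign_smul_hom {N : ModuleCat.{0} ℂ} (f : ModuleCat.of ℂ ℂ ⟶ N) (c : ℂ) (i : ℕ) :
    c • (-1 : ℂ) ^ i • f.hom (1 : ℂ) = ModuleCat.Hom.hom ((-1 : ℤ) ^ i • f) c := by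
  have h : f.hom c = c • f.hom (1 : ℂ) := by
    rw [← map_smul]
    exact congrArg f.hom (mul_one c).symm
  rw [ModuleCat.hom_zsmul, LinearMap.smul_apply, h, ← Int.cast_smul_eq_zsmul ℂ, smul_comm]
  push_cast
  rfl

theorem singChainEquiv_boundary (m : ℕ) (X : Type) [TopologicalSpace X] (z : SingChain (m + 1) X) :
    singChainEquiv m X (singBoundary m X z) =
      ((singularComplexC X).d (m + 1) m).hom (singChainEquiv (m + 1) X z) := by
  induction z using Finsupp.induction_linear with
  | zero => simp
  | add x y hx hy => simp only [map_add, hx, hy]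
  | single σ c =>
    have h := SSet.ιChainComplex_d (TopCat.toSSet.obj (TopCat.of X)) (ModuleCat.of ℂ ℂ)
      (singSimplex σ)
    have h' := congrArg (fun f => (ModuleCat.Hom.hom f) c) h
    rw [singChainEquiv_single]
    refine Eq.trans ?_ h'.symm
    simp only [singBoundary, Finsupp.linearCombination_single, map_smul, map_sum,
      ModuleCat.hom_sum, LinearMap.sum_apply, Finset.smul_sum]
    refine Finset.sum_congr rfl fun i _ => ?_
    rw [singChainEquiv_single, singSimplex_face]
    exact smul_sign_smul_hom _ c i

theorem singChainEquiv_push (m : ℕ) {X Y : Type} [TopologicalSpace X] [TopologicalSpace Y]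
    (f : C(X, Y)) (z : SingChain m X) :
    singChainEquiv m Y (singPush m f z) =
      ((((AlgebraicTopology.singularChainComplexFunctor (ModuleCat.{0} ℂ)).obj
        (ModuleCat.of ℂ ℂ)).map (TopCat.ofHom f)).f m).hom (singChainEquiv m X z) := by
  induction z using Finsupp.induction_linear with
  | zero => simp
  | add x y hx hy => simp only [map_add, hx, hy]
  | single σ c =>
    have h := SSet.ι_chainComplexMap_f (TopCat.toSSet.obj (TopCat.of X))
      (TopCat.toSSet.obj (TopCat.of Y)) (TopCat.toSSet.map (TopCat.ofHom f)) (ModuleCat.of ℂ ℂ)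
      (singSimplex σ)
    have h' := congrArg (fun f => (ModuleCat.Hom.hom f) c) h
    rw [singChainEquiv_single]
    refine Eq.trans ?_ h'.symm
    rw [singSimplex_push, singPush, Finsupp.lmapDomain_apply, Finsupp.mapDomain_single,
      singChainEquiv_single]

/-- The singular cycle `z` represents the homology class `h`. -/
def RepresentsClass {m : ℕ} {X : Type} [TopologicalSpace X] (z : SingChain m X)
    (h : HomologyC m X) : Prop :=
  ∃ c : (singularComplexC X).cycles m,
    ((singularComplexC X).iCycles m).hom c = singChainEquiv m X z ∧
      ((singularComplexC X).homologyπ m).hom c = h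

section
variable {m : ℕ} {X Y : Type} [TopologicalSpace X] [TopologicalSpace Y]

theorem RepresentsClass.add {z z' : SingChain m X} {h h' : HomologyC m X}
    (hz : RepresentsClass z h) (hz' : RepresentsClass z' h') : RepresentsClass (z + z') (h + h') := by
  obtain ⟨c, hc, hc'⟩ := hz
  obtain ⟨d, hd, hd'⟩ := hz'
  exact ⟨c + d, by rw [map_add, map_add, hc, hd], by rw [map_add, hc', hd']; rfl⟩

theorem RepresentsClass.smul {z : SingChain m X} {h : HomologyC m X} (a : ℂ)
    (hz : RepresentsClass z h) : RepresentsClass (a • z) (a • h) := by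
  obtain ⟨c, hc, hc'⟩ := hz
  exact ⟨a • c, by rw [map_smul, map_smul, hc], by rw [map_smul, hc']; rfl⟩

theorem exists_representsClass (h : HomologyC m X) : ∃ z : SingChain m X, RepresentsClass z h := by
  obtain ⟨c, hc⟩ := (ModuleCat.epi_iff_surjective _).1
    (inferInstance : Epi ((singularComplexC X).homologyπ m)) h
  exact ⟨(singChainEquiv m X).symm (((singularComplexC X).iCycles m).hom c), c, by simp, hc⟩

theorem RepresentsClass.push {z : SingChain m X} {h : HomologyC m X} (f : C(X, Y))
    (hz : RepresentsClass z h) : RepresentsClass (singPush m f z) (homologyCMap m f h) := by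
  obtain ⟨c, hc, rfl⟩ := hz
  let φ := ((AlgebraicTopology.singularChainComplexFunctor (ModuleCat.{0} ℂ)).obj
        (ModuleCat.of ℂ ℂ)).map (TopCat.ofHom f)
  refine ⟨(HomologicalComplex.cyclesMap φ m).hom c, ?_, ?_⟩
  · rw [singChainEquiv_push, ← hc]
    exact congrArg (fun f => (ModuleCat.Hom.hom f) c) (HomologicalComplex.cyclesMap_i φ m)
  · exact (congrArg (fun f => (ModuleCat.Hom.hom f) c) (HomologicalComplex.homologyπ_naturality φ m)).symm

theorem RepresentsClass.boundary_eq_zero {z : SingChain (m + 1) X} {h : HomologyC (m + 1) X}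
    (hz : RepresentsClass z h) : singBoundary m X z = 0 := by
  obtain ⟨c, hc, rfl⟩ := hz
  apply (singChainEquiv m X).injective
  rw [singChainEquiv_boundary, ← hc, map_zero]
  exact congrArg (fun f => (ModuleCat.Hom.hom f) c) ((singularComplexC X).iCycles_d (m + 1) m)

/-- The degree `j` is a parameter so that degree 0 is covered as well: there `next` takes its
default value, and the differential is zero because the degrees are unrelated. -/
theorem exists_class_of_d_eq_zero (z : SingChain m X) (j : ℕ)
    (hj : (ComplexShape.down ℕ).next m = j)
    (hz : ((singularComplexC X).d m j).hom (singChainEquiv m X z) = 0) :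
    ∃ h : HomologyC m X, RepresentsClass z h := by
  let k : ModuleCat.of ℂ ℂ ⟶ (singularComplexC X).X m :=
    ModuleCat.ofHom (LinearMap.toSpanSingleton ℂ _ (singChainEquiv m X z))
  have hk : k ≫ (singularComplexC X).d m j = 0 := by
    ext
    exact (congrArg ((singularComplexC X).d m j).hom (one_smul ℂ (singChainEquiv m X z))).trans hz
  refine ⟨_, ((singularComplexC X).liftCycles k j hj hk).hom 1, ?_, rfl⟩
  have := congrArg (fun f => (ModuleCat.Hom.hom f) (1 : ℂ))
    ((singularComplexC X).liftCycles_i k j hj hk)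
  exact this.trans (one_smul ℂ (singChainEquiv m X z))

theorem exists_class_of_boundary_eq_zero {z : SingChain (m + 1) X} (hz : singBoundary m X z = 0) :
    ∃ h : HomologyC (m + 1) X, RepresentsClass z h := by
  refine exists_class_of_d_eq_zero z m (by simp) ?_
  rw [← singChainEquiv_boundary, hz, map_zero]

theorem exists_class_zero (z : SingChain 0 X) : ∃ h : HomologyC 0 X, RepresentsClass z h := by
  refine exists_class_of_d_eq_zero z _ rfl ?_
  rw [(singularComplexC X).shape _ _ (by simp)]
  rfl

theorem RepresentsClass.unique {z : SingChain m X} {h h' : HomologyC m X}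
    (hz : RepresentsClass z h) (hz' : RepresentsClass z h') : h = h' := by
  obtain ⟨c, hc, rfl⟩ := hz
  obtain ⟨d, hd, rfl⟩ := hz'
  have : c = d := (ModuleCat.mono_iff_injective _).1
    (inferInstance : Mono ((singularComplexC X).iCycles m)) (hc.trans hd.symm)
  rw [this]

theorem representsClass_boundary (y : SingChain (m + 1) X) :
    RepresentsClass (singBoundary m X y) (0 : HomologyC m X) := by
  refine ⟨((singularComplexC X).toCycles (m + 1) m).hom (singChainEquiv (m + 1) X y), ?_, ?_⟩
  · rw [singChainEquiv_boundary]
    exact congrArg (fun f => (ModuleCat.Hom.hom f) (singChainEquiv (m + 1) X y))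
      ((singularComplexC X).toCycles_i (m + 1) m)
  · exact congrArg (fun f => (ModuleCat.Hom.hom f) (singChainEquiv (m + 1) X y))
      ((singularComplexC X).toCycles_comp_homologyπ (m + 1) m)

theorem RepresentsClass.exists_boundary {z : SingChain m X}
    (hz : RepresentsClass z (0 : HomologyC m X)) : ∃ y, singBoundary m X y = z := by
  obtain ⟨c, hc, h0⟩ := hz
  have hex : ((ShortComplex.mk _ _ ((singularComplexC X).toCycles_comp_homologyπ (m + 1) m))).Exact :=
    ShortComplex.exact_of_g_is_cokernel _
      ((singularComplexC X).homologyIsCokernel (m + 1) m (by simp))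
  obtain ⟨y, hy⟩ := (ShortComplex.moduleCat_exact_iff _).1 hex c h0
  refine ⟨(singChainEquiv (m + 1) X).symm y, (singChainEquiv m X).injective ?_⟩
  rw [singChainEquiv_boundary, LinearEquiv.apply_symm_apply, ← hc, ← hy]
  exact (congrArg (fun f => (ModuleCat.Hom.hom f) y) ((singularComplexC X).toCycles_i (m + 1) m)).symm

end

/-! ### Barycentric subdivision of formal tuples -/

/-- Formal combinations of ordered `k`-tuples. -/
abbrev TupleChain (k : ℕ) (V : Type) : Type := (Fin k → V) →₀ ℂ

theorem map_mem_of_mem_supported {α N : Type*} [AddCommGroup N] [Module ℂ N]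
    (f : (α →₀ ℂ) →ₗ[ℂ] N) {s : Set α} {P : Submodule ℂ N}
    (h : ∀ a ∈ s, f (Finsupp.single a 1) ∈ P) {c : α →₀ ℂ}
    (hc : c ∈ Finsupp.supported ℂ ℂ s) : f c ∈ P := by
  rw [Finsupp.supported_eq_span_single] at hc
  have : Submodule.span ℂ ((fun i => Finsupp.single i (1 : ℂ)) '' s) ≤ P.comap f := by
    rw [Submodule.span_le]
    rintro _ ⟨a, ha, rfl⟩
    exact h a ha
  exact this hc

namespace TupleChain

variable {V W : Type} {k : ℕ}

/-- The alternating sum of the faces. -/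
def boundary (k : ℕ) (V : Type) : TupleChain (k + 1) V →ₗ[ℂ] TupleChain k V :=
  Finsupp.linearCombination ℂ fun v =>
    ∑ i : Fin (k + 1), (-1 : ℂ) ^ (i : ℕ) • Finsupp.single (v ∘ i.succAbove) 1

/-- The cone with apex `b`. -/
def cone (b : V) : TupleChain k V →ₗ[ℂ] TupleChain (k + 1) V :=
  Finsupp.lmapDomain ℂ ℂ fun v => (Fin.cons b v : Fin (k + 1) → V)

/-- The map induced by a map of vertices. -/
def push (f : V → W) : TupleChain k V →ₗ[ℂ] TupleChain k W :=
  Finsupp.lmapDomain ℂ ℂ fun v => f ∘ v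

@[simp]
theorem boundary_single (v : Fin (k + 1) → V) : boundary k V (Finsupp.single v 1) =
    ∑ i : Fin (k + 1), (-1 : ℂ) ^ (i : ℕ) • Finsupp.single (v ∘ i.succAbove) 1 := by
  simp [boundary]

@[simp]
theorem cone_single (b : V) (v : Fin k → V) (c : ℂ) :
    cone b (Finsupp.single v c) = Finsupp.single (Fin.cons b v : Fin (k + 1) → V) c := by
  simp [cone]

@[simp]
theorem push_single (f : V → W) (v : Fin k → V) (c : ℂ) :
    push f (Finsupp.single v c) = Finsupp.single (f ∘ v) c := by
  simp [push]

theorem hom_ext {N : Type*} [AddCommGroup N] [Module ℂ N] {f g : TupleChain k V →ₗ[ℂ] N}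
    (h : ∀ v, f (Finsupp.single v 1) = g (Finsupp.single v 1)) : f = g :=
  Finsupp.lhom_ext' fun v => LinearMap.ext_ring (h v)

/-- Chains are indexed by the number of vertices, so the boundary from 1-tuples to the empty tuple
is the augmentation. In this lowest degree the cone formula has no correction term. -/
theorem boundary_cone_zero (b : V) (c : TupleChain 0 V) : boundary 0 V (cone b c) = c := by
  suffices h : boundary 0 V ∘ₗ cone b = LinearMap.id from LinearMap.congr_fun h c
  refine hom_ext fun v => ?_
  simp only [LinearMap.comp_apply, cone_single, boundary_single, LinearMap.id_apply]
  simp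

/-- The zeroth face omits the apex; each other face is a cone over a face, with index shifted by one
and hence opposite sign. -/
theorem boundary_cone (b : V) (c : TupleChain (k + 1) V) :
    boundary (k + 1) V (cone b c) = c - cone b (boundary k V c) := by
  suffices h : boundary (k + 1) V ∘ₗ cone b = LinearMap.id - cone b ∘ₗ boundary k V from
    LinearMap.congr_fun h c
  refine hom_ext fun v => ?_
  simp only [LinearMap.comp_apply, cone_single, boundary_single, LinearMap.id_apply,
    LinearMap.sub_apply, map_sum, map_smul]
  rw [Fin.sum_univ_succ, sub_eq_add_neg, ← Finset.sum_neg_distrib]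
  congr 1
  · simp only [Fin.val_zero, pow_zero, one_smul]
    congr 1
  · refine Finset.sum_congr rfl fun i _ => ?_
    rw [← neg_smul, Fin.val_succ, pow_succ, mul_neg_one]
    congr 2
    funext j
    refine Fin.cases ?_ (fun j => ?_) j
    · simp
    · simp [Fin.succ_succAbove_succ]

/-- Every nonempty tuple is the cone over its tail, so the cone formula and induction replace the
usual cancellation in a double sum. -/
theorem boundary_boundary (c : TupleChain (k + 2) V) :
    boundary k V (boundary (k + 1) V c) = 0 := by
  suffices h : boundary k V ∘ₗ boundary (k + 1) V = 0 from LinearMap.congr_fun h c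
  refine hom_ext fun v => ?_
  have hv : Finsupp.single v (1 : ℂ) = cone (v 0) (Finsupp.single (Fin.tail v) 1) := by
    rw [cone_single, Fin.cons_self_tail]
  rw [hv, LinearMap.comp_apply, boundary_cone, map_sub, LinearMap.zero_apply]
  induction k with
  | zero => rw [boundary_cone_zero, sub_self]
  | succ k ih =>
    have hv' : Finsupp.single (Fin.tail v) (1 : ℂ) =
        cone (Fin.tail v 0) (Finsupp.single (Fin.tail (Fin.tail v)) 1) := by
      rw [cone_single, Fin.cons_self_tail]
    have := ih (boundary _ V (Finsupp.single v 1)) (Fin.tail v) hv'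
    rw [boundary_cone, hv', boundary_cone, map_sub, this, map_zero, sub_zero, sub_self]

theorem push_boundary (f : V → W) (c : TupleChain (k + 1) V) :
    push f (boundary k V c) = boundary k W (push f c) := by
  suffices h : push f ∘ₗ boundary k V = boundary k W ∘ₗ push f from LinearMap.congr_fun h c
  refine hom_ext fun v => ?_
  simp [Function.comp_assoc]

theorem push_cone (f : V → W) (b : V) (c : TupleChain k V) :
    push f (cone b c) = cone (f b) (push f c) := by
  suffices h : push f ∘ₗ cone b = cone (f b) ∘ₗ push (k := k) f from LinearMap.congr_fun h c
  refine hom_ext fun v => ?_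
  simp only [LinearMap.comp_apply, cone_single, push_single]
  congr 1
  funext j
  refine Fin.cases ?_ (fun j => ?_) j <;> simp

variable (β : ∀ k, (Fin (k + 1) → V) → V)

/-- The homotopy between subdivision and the identity, for a choice `β` of barycenters. -/
def homotopyOp : ∀ k, TupleChain k V →ₗ[ℂ] TupleChain (k + 1) V
  | 0 => 0
  | k + 1 => Finsupp.linearCombination ℂ fun v =>
      cone (β k v) (Finsupp.single v 1 - homotopyOp k (boundary k V (Finsupp.single v 1)))

/-- Barycentric subdivision, for a choice `β` of barycenters. -/
def subdiv : ∀ k, TupleChain k V →ₗ[ℂ] TupleChain k V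
  | 0 => LinearMap.id
  | k + 1 => LinearMap.id - boundary (k + 1) V ∘ₗ homotopyOp β (k + 1) -
      homotopyOp β k ∘ₗ boundary k V

theorem homotopyOp_single (v : Fin (k + 1) → V) : homotopyOp β (k + 1) (Finsupp.single v 1) =
    cone (β k v) (Finsupp.single v 1 - homotopyOp β k (boundary k V (Finsupp.single v 1))) := by
  simp [homotopyOp]

theorem subdiv_apply (c : TupleChain (k + 1) V) : subdiv β (k + 1) c =
    c - boundary (k + 1) V (homotopyOp β (k + 1) c) - homotopyOp β k (boundary k V c) := rfl

/-- `subdiv` is defined through the homotopy formula, which makes it homologous to the identity at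
once. The cone formula recovers the geometric description: subdivide the boundary and join it to the
barycenter. -/
theorem subdiv_single (v : Fin (k + 1) → V) : subdiv β (k + 1) (Finsupp.single v 1) =
    cone (β k v) (subdiv β k (boundary k V (Finsupp.single v 1))) := by
  rw [subdiv_apply, homotopyOp_single, boundary_cone]
  cases k with
  | zero => simp [homotopyOp, subdiv]
  | succ k =>
    rw [subdiv_apply, boundary_boundary, map_zero, map_sub (boundary (k + 1) V)]
    simp only [sub_zero, map_sub]
    abel

variable {β} {β' : ∀ k, (Fin (k + 1) → W) → W}

theorem push_homotopyOp {f : V → W} (hf : ∀ k v, f (β k v) = β' k (f ∘ v)) (c : TupleChain k V) :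
    push f (homotopyOp β k c) = homotopyOp β' k (push f c) := by
  induction k with
  | zero => simp [homotopyOp]
  | succ k ih =>
    suffices h : push f ∘ₗ homotopyOp β (k + 1) = homotopyOp β' (k + 1) ∘ₗ push f from
      LinearMap.congr_fun h c
    refine hom_ext fun v => ?_
    rw [LinearMap.comp_apply, LinearMap.comp_apply, homotopyOp_single, push_cone, map_sub, ih,
      push_boundary, push_single, homotopyOp_single, hf]

theorem push_subdiv {f : V → W} (hf : ∀ k v, f (β k v) = β' k (f ∘ v)) (c : TupleChain k V) :
    push f (subdiv β k c) = subdiv β' k (push f c) := by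
  cases k with
  | zero => rfl
  | succ k =>
    rw [subdiv_apply, subdiv_apply, map_sub, map_sub, push_boundary, push_homotopyOp hf,
      push_homotopyOp hf, push_boundary]

/-- The pieces of a subdivided small simplex are smaller, and lie in every ball that contains the
vertices of the simplex. -/
theorem subdiv_single_mem [PseudoMetricSpace V] {K : ℕ} {ρ : ℝ}
    (hball : ∀ k v x r, (∀ i, dist (v i) x ≤ r) → dist (β k v) x ≤ r)
    (hβ : ∀ k, k < K → ∀ v D, (∀ i j, dist (v i) (v j) ≤ D) → ∀ j, dist (β k v) (v j) ≤ ρ * D)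
    (hk : k ≤ K) (v : Fin k → V) {D : ℝ} (hD : 0 ≤ ρ * D) (hv : ∀ i j, dist (v i) (v j) ≤ D) :
    subdiv β k (Finsupp.single v 1) ∈ Finsupp.supported ℂ ℂ
      {w : Fin k → V | (∀ i j, dist (w i) (w j) ≤ ρ * D) ∧
        ∀ x r, (∀ i, dist (v i) x ≤ r) → ∀ i, dist (w i) x ≤ r} := by
  induction k with
  | zero => exact Finsupp.single_mem_supported _ _ ⟨fun i => i.elim0, fun _ _ _ i => i.elim0⟩
  | succ k ih =>
    rw [subdiv_single, boundary_single, map_sum, map_sum]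
    refine Submodule.sum_mem _ fun i _ => ?_
    rw [map_smul, map_smul]
    refine Submodule.smul_mem _ _ (map_mem_of_mem_supported _ ?_
      (ih (by omega) (v ∘ i.succAbove) fun _ _ => hv _ _))
    rintro w ⟨hw, hw'⟩
    rw [cone_single]
    refine Finsupp.single_mem_supported _ _ ⟨?_, fun x r h => ?_⟩
    -- The ball clause of the induction hypothesis, for the ball of radius `ρ * D` about the
    -- barycenter: it contains the vertices of the face, hence all pieces of its subdivision.
    · have key : ∀ j, dist (w j) (β k v) ≤ ρ * D := hw' _ _ fun j => by
        rw [dist_comm]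
        exact hβ k (by omega) v D hv _
      refine Fin.cases (Fin.cases ?_ fun j => ?_) fun i => Fin.cases ?_ fun j => ?_
      · simpa using hD
      · simpa [dist_comm] using key j
      · simpa using key i
      · simpa using hw i j
    · refine Fin.cases ?_ fun j => ?_
      · simpa using hball k v x r h
      · simpa using hw' x r (fun i => h _) j

theorem iterate_subdiv_mem [PseudoMetricSpace V] {ρ : ℝ} (hρ : 0 ≤ ρ)
    (hball : ∀ k v x r, (∀ i, dist (v i) x ≤ r) → dist (β k v) x ≤ r)
    (hβ : ∀ j, j < k → ∀ v D, (∀ i j, dist (v i) (v j) ≤ D) → ∀ i, dist (β j v) (v i) ≤ ρ * D)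
    (v : Fin k → V) {D : ℝ} (hD : 0 ≤ D) (hv : ∀ i j, dist (v i) (v j) ≤ D) (N : ℕ) :
    (subdiv β k)^[N] (Finsupp.single v 1) ∈ Finsupp.supported ℂ ℂ
      {w : Fin k → V | ∀ i j, dist (w i) (w j) ≤ ρ ^ N * D} := by
  induction N with
  | zero =>
    refine Finsupp.single_mem_supported _ _ ?_
    simpa using hv
  | succ N ih =>
    rw [Function.iterate_succ_apply']
    refine map_mem_of_mem_supported _ (fun w hw => ?_) ih
    refine Finsupp.supported_mono ?_ (subdiv_single_mem hball hβ le_rfl w (by positivity) hw)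
    rintro u ⟨hu, -⟩
    intro i j
    rw [pow_succ', mul_assoc]
    exact hu i j

end TupleChain

/-! ### Affine simplices and the diameter estimate -/

section AffineSimplex

variable {ι κ : Type} [Fintype ι] [Fintype κ] {k : ℕ}

/-- The affine simplex with given vertices in a standard simplex. -/
def affineSimplex (v : κ → stdSimplex ℝ ι) : C(stdSimplex ℝ κ, stdSimplex ℝ ι) where
  toFun x := ⟨∑ i, x.1 i • (v i).1, (convex_stdSimplex ℝ ι).sum_mem (fun i _ => x.2.1 i) x.2.2
    fun i _ => (v i).2⟩
  continuous_toFun := by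
    refine Continuous.subtype_mk (continuous_finsetSum _ fun i _ => ?_) _
    exact ((continuous_apply i).comp continuous_subtype_val).smul continuous_const

theorem affineSimplex_coe (v : κ → stdSimplex ℝ ι) (x : stdSimplex ℝ κ) :
    (affineSimplex v x).1 = ∑ i, x.1 i • (v i).1 := rfl

theorem affineSimplex_affineSimplex {μ : Type} [Fintype μ] (v : κ → stdSimplex ℝ ι)
    (w : μ → stdSimplex ℝ κ) (x : stdSimplex ℝ μ) :
    affineSimplex v (affineSimplex w x) = affineSimplex (affineSimplex v ∘ w) x := by
  apply Subtype.ext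
  simp only [affineSimplex_coe, Finset.sum_apply, Pi.smul_apply, smul_eq_mul, Finset.sum_smul,
    Function.comp_apply, Finset.smul_sum]
  rw [Finset.sum_comm]
  simp only [mul_smul]

theorem affineSimplex_comp {μ : Type} [Fintype μ] (v : κ → stdSimplex ℝ ι)
    (w : μ → stdSimplex ℝ κ) :
    (affineSimplex v).comp (affineSimplex w) = affineSimplex (affineSimplex v ∘ w) :=
  ContinuousMap.ext fun x => affineSimplex_affineSimplex v w x

theorem affineSimplex_vertex [DecidableEq κ] (v : κ → stdSimplex ℝ ι) (i : κ) :
    affineSimplex v (stdSimplex.vertex i) = v i := by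
  apply Subtype.ext
  rw [affineSimplex_coe, Finset.sum_eq_single i]
  · simp
  · intro j _ hj
    simp [Pi.single_eq_of_ne hj]
  · simp

theorem affineSimplex_comp_vertex [DecidableEq κ] (v : κ → stdSimplex ℝ ι) :
    affineSimplex v ∘ stdSimplex.vertex = v := funext fun i => affineSimplex_vertex v i

theorem affineSimplex_vertex_eq_id [DecidableEq ι] :
    affineSimplex (stdSimplex.vertex : ι → stdSimplex ℝ ι) = ContinuousMap.id _ := by
  refine ContinuousMap.ext fun x => Subtype.ext (funext fun j => ?_)
  rw [affineSimplex_coe, Finset.sum_apply, Finset.sum_eq_single j]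
  · simp
  · intro i _ hi
    simp [Pi.single_eq_of_ne hi.symm]
  · simp

theorem map_eq_affineSimplex [DecidableEq ι] (f : κ → ι) (x : stdSimplex ℝ κ) :
    stdSimplex.map f x = affineSimplex (fun i => stdSimplex.vertex (f i)) x := by
  apply Subtype.ext
  funext j
  change FunOnFinite.linearMap ℝ ℝ f x.1 j = _
  rw [FunOnFinite.linearMap_apply_apply, affineSimplex_coe, Finset.sum_apply, Finset.sum_filter]
  refine Finset.sum_congr rfl fun i _ => ?_
  by_cases h : f i = j
  · subst h
    simp
  · simp [h]

theorem faceMap_eq_affineSimplex (m : ℕ) (i : Fin (m + 2)) :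
    faceMap m i = affineSimplex (stdSimplex.vertex ∘ i.succAbove) :=
  ContinuousMap.ext fun x => map_eq_affineSimplex _ x

theorem dist_affineSimplex_le (v : κ → stdSimplex ℝ ι) (t : stdSimplex ℝ κ) (x : stdSimplex ℝ ι)
    {r : ℝ} (h : ∀ i, dist (v i) x ≤ r) : dist (affineSimplex v t) x ≤ r :=
  (convex_closedBall x.1 r).sum_mem (fun i _ => t.2.1 i) t.2.2 fun i _ => h i

/-- The barycenter of an ordered simplex. -/
def baryPoint (k : ℕ) (v : Fin (k + 1) → stdSimplex ℝ ι) : stdSimplex ℝ ι :=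
  affineSimplex v stdSimplex.barycenter

theorem affineSimplex_baryPoint (u : κ → stdSimplex ℝ ι) (k : ℕ)
    (v : Fin (k + 1) → stdSimplex ℝ κ) :
    affineSimplex u (baryPoint k v) = baryPoint k (affineSimplex u ∘ v) :=
  affineSimplex_affineSimplex _ _ _

/-- The difference is the average of the k + 1 vectors from `v j` to the vertices, one of which
vanishes; hence the factor k/(k+1). -/
theorem dist_baryPoint_le (v : Fin (k + 1) → stdSimplex ℝ ι) {D : ℝ}
    (hv : ∀ i j, dist (v i) (v j) ≤ D) (j : Fin (k + 1)) :
    dist (baryPoint k v) (v j) ≤ k / (k + 1) * D := by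
  have hk : (0 : ℝ) < k + 1 := by positivity
  have h : (baryPoint k v).1 - (v j).1 = ((k : ℝ) + 1)⁻¹ • ∑ i ∈ Finset.univ.erase j,
      ((v i).1 - (v j).1) := by
    have h1 : ∑ i ∈ Finset.univ.erase j, ((v i).1 - (v j).1) = ∑ i, ((v i).1 - (v j).1) := by
      rw [← Finset.add_sum_erase _ _ (Finset.mem_univ j), sub_self, zero_add]
    rw [h1, Finset.sum_sub_distrib, smul_sub, Finset.smul_sum]
    congr 1
    · rw [baryPoint, affineSimplex_coe]
      refine Finset.sum_congr rfl fun i _ => ?_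
      simp
    · rw [Finset.sum_const, Finset.card_univ, Fintype.card_fin, ← Nat.cast_smul_eq_nsmul ℝ,
        smul_smul]
      push_cast
      rw [inv_mul_cancel₀ hk.ne', one_smul]
  rw [Subtype.dist_eq, dist_eq_norm, h, norm_smul, norm_inv, Real.norm_of_nonneg hk.le]
  have h2 : ‖∑ i ∈ Finset.univ.erase j, ((v i).1 - (v j).1)‖ ≤ k * D := by
    refine (norm_sum_le_of_le (Finset.univ.erase j) (f := fun i => (v i).1 - (v j).1)
      (n := fun _ => D) fun i _ => ?_).trans ?_
    · rw [← dist_eq_norm]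
      exact hv i j
    · simp
  calc ((k : ℝ) + 1)⁻¹ * _ ≤ ((k : ℝ) + 1)⁻¹ * (k * D) := by gcongr
    _ = k / (k + 1) * D := by ring

end AffineSimplex

/-! ### Subdivision of singular chains and small simplices -/

section Subdivision

variable {X Y : Type} [TopologicalSpace X] [TopologicalSpace Y] {m k : ℕ}

/-- The singular chain obtained by applying a singular simplex to affine simplices. -/
def realizeChain (k : ℕ) (σ : C(stdSimplex ℝ (Fin (m + 1)), X)) :
    TupleChain (k + 1) (stdSimplex ℝ (Fin (m + 1))) →ₗ[ℂ] SingChain k X :=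
  Finsupp.lmapDomain ℂ ℂ fun v => σ.comp (affineSimplex v)

@[simp]
theorem realizeChain_single (σ : C(stdSimplex ℝ (Fin (m + 1)), X))
    (v : Fin (k + 1) → stdSimplex ℝ (Fin (m + 1))) (c : ℂ) :
    realizeChain k σ (Finsupp.single v c) = Finsupp.single (σ.comp (affineSimplex v)) c := by
  simp [realizeChain]

/-- The identity simplex as an ordered simplex. -/
def vertexChain (m : ℕ) : TupleChain (m + 1) (stdSimplex ℝ (Fin (m + 1))) :=
  Finsupp.single stdSimplex.vertex 1

theorem realizeChain_vertexChain (σ : C(stdSimplex ℝ (Fin (m + 1)), X)) :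
    realizeChain m σ (vertexChain m) = Finsupp.single σ 1 := by
  rw [vertexChain, realizeChain_single, affineSimplex_vertex_eq_id, ContinuousMap.comp_id]

theorem singBoundary_realizeChain (σ : C(stdSimplex ℝ (Fin (m + 1)), X))
    (c : TupleChain (k + 2) (stdSimplex ℝ (Fin (m + 1)))) :
    singBoundary k X (realizeChain (k + 1) σ c) =
      realizeChain k σ (TupleChain.boundary (k + 1) _ c) := by
  suffices h : singBoundary k X ∘ₗ realizeChain (k + 1) σ =
      realizeChain k σ ∘ₗ TupleChain.boundary (k + 1) _ from LinearMap.congr_fun h c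
  refine TupleChain.hom_ext fun v => ?_
  simp only [LinearMap.comp_apply, realizeChain_single, singBoundary,
    Finsupp.linearCombination_single, one_smul, TupleChain.boundary_single, map_sum, map_smul]
  refine Finset.sum_congr rfl fun i _ => ?_
  rw [ContinuousMap.comp_assoc, faceMap_eq_affineSimplex, affineSimplex_comp,
    ← Function.comp_assoc, affineSimplex_comp_vertex]

theorem realizeChain_comp_affineSimplex {l : ℕ} (σ : C(stdSimplex ℝ (Fin (m + 1)), X))
    (v : Fin (l + 1) → stdSimplex ℝ (Fin (m + 1)))
    (c : TupleChain (k + 1) (stdSimplex ℝ (Fin (l + 1)))) :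
    realizeChain k (σ.comp (affineSimplex v)) c =
      realizeChain k σ (TupleChain.push (affineSimplex v) c) := by
  suffices h : realizeChain k (σ.comp (affineSimplex v)) =
      realizeChain k σ ∘ₗ TupleChain.push (affineSimplex v) from LinearMap.congr_fun h c
  refine TupleChain.hom_ext fun w => ?_
  simp only [LinearMap.comp_apply, realizeChain_single, TupleChain.push_single]
  rw [ContinuousMap.comp_assoc, affineSimplex_comp]

/-- The homotopy from subdivision to the identity, on singular chains. -/
def singHomotopyOp (k : ℕ) (X : Type) [TopologicalSpace X] :
    SingChain k X →ₗ[ℂ] SingChain (k + 1) X :=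
  Finsupp.linearCombination ℂ fun σ =>
    realizeChain (k + 1) σ (TupleChain.homotopyOp baryPoint (k + 1) (vertexChain k))

/-- Barycentric subdivision of singular chains. -/
def singSubdiv (k : ℕ) (X : Type) [TopologicalSpace X] : SingChain k X →ₗ[ℂ] SingChain k X :=
  Finsupp.linearCombination ℂ fun σ =>
    realizeChain k σ (TupleChain.subdiv baryPoint (k + 1) (vertexChain k))

/-- Affine maps preserve barycenters, so the operator may be computed inside one standard simplex
before applying `σ`. The same holds for `singSubdiv`, and the homotopy formula for singular chains
follows from the one for tuples. -/
theorem singHomotopyOp_realizeChain (σ : C(stdSimplex ℝ (Fin (m + 1)), X))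
    (c : TupleChain (k + 1) (stdSimplex ℝ (Fin (m + 1)))) :
    singHomotopyOp k X (realizeChain k σ c) =
      realizeChain (k + 1) σ (TupleChain.homotopyOp baryPoint (k + 1) c) := by
  suffices h : singHomotopyOp k X ∘ₗ realizeChain k σ =
      realizeChain (k + 1) σ ∘ₗ TupleChain.homotopyOp baryPoint (k + 1) from
    LinearMap.congr_fun h c
  refine TupleChain.hom_ext fun v => ?_
  simp only [LinearMap.comp_apply, realizeChain_single, singHomotopyOp,
    Finsupp.linearCombination_single, one_smul]
  rw [realizeChain_comp_affineSimplex,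
    TupleChain.push_homotopyOp (β' := baryPoint) (affineSimplex_baryPoint v), vertexChain,
    TupleChain.push_single, affineSimplex_comp_vertex]

theorem singSubdiv_realizeChain (σ : C(stdSimplex ℝ (Fin (m + 1)), X))
    (c : TupleChain (k + 1) (stdSimplex ℝ (Fin (m + 1)))) :
    singSubdiv k X (realizeChain k σ c) =
      realizeChain k σ (TupleChain.subdiv baryPoint (k + 1) c) := by
  suffices h : singSubdiv k X ∘ₗ realizeChain k σ =
      realizeChain k σ ∘ₗ TupleChain.subdiv baryPoint (k + 1) from LinearMap.congr_fun h c
  refine TupleChain.hom_ext fun v => ?_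
  simp only [LinearMap.comp_apply, realizeChain_single, singSubdiv,
    Finsupp.linearCombination_single, one_smul]
  rw [realizeChain_comp_affineSimplex,
    TupleChain.push_subdiv (β' := baryPoint) (affineSimplex_baryPoint v), vertexChain,
    TupleChain.push_single, affineSimplex_comp_vertex]

theorem singSubdiv_zero_eq (z : SingChain 0 X) :
    singSubdiv 0 X z = z - singBoundary 0 X (singHomotopyOp 0 X z) := by
  suffices h : singSubdiv 0 X = LinearMap.id - singBoundary 0 X ∘ₗ singHomotopyOp 0 X from
    LinearMap.congr_fun h z
  refine Finsupp.lhom_ext' fun σ => LinearMap.ext_ring ?_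
  change singSubdiv 0 X (Finsupp.single σ 1) = Finsupp.single σ 1 -
    singBoundary 0 X (singHomotopyOp 0 X (Finsupp.single σ 1))
  rw [← realizeChain_vertexChain, singSubdiv_realizeChain, singHomotopyOp_realizeChain,
    singBoundary_realizeChain, TupleChain.subdiv_apply, map_sub, map_sub]
  simp [TupleChain.homotopyOp]

theorem singSubdiv_succ_eq (z : SingChain (k + 1) X) :
    singSubdiv (k + 1) X z = z - singBoundary (k + 1) X (singHomotopyOp (k + 1) X z) -
      singHomotopyOp k X (singBoundary k X z) := by
  suffices h : singSubdiv (k + 1) X = LinearMap.id -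
      singBoundary (k + 1) X ∘ₗ singHomotopyOp (k + 1) X -
        singHomotopyOp k X ∘ₗ singBoundary k X from LinearMap.congr_fun h z
  refine Finsupp.lhom_ext' fun σ => LinearMap.ext_ring ?_
  change singSubdiv (k + 1) X (Finsupp.single σ 1) = Finsupp.single σ 1 -
    singBoundary (k + 1) X (singHomotopyOp (k + 1) X (Finsupp.single σ 1)) -
      singHomotopyOp k X (singBoundary k X (Finsupp.single σ 1))
  rw [← realizeChain_vertexChain, singSubdiv_realizeChain, singHomotopyOp_realizeChain,
    singBoundary_realizeChain, singBoundary_realizeChain, singHomotopyOp_realizeChain,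
    TupleChain.subdiv_apply, map_sub, map_sub]

theorem RepresentsClass.subdiv {z : SingChain m X} {h : HomologyC m X} (hz : RepresentsClass z h) :
    RepresentsClass (singSubdiv m X z) h := by
  have key : singSubdiv m X z = z + (-1 : ℂ) • singBoundary m X (singHomotopyOp m X z) := by
    cases m with
    | zero => rw [singSubdiv_zero_eq, neg_one_smul, sub_eq_add_neg]
    | succ m => rw [singSubdiv_succ_eq, hz.boundary_eq_zero, map_zero, sub_zero, neg_one_smul,
        sub_eq_add_neg]
  rw [key]
  simpa using hz.add ((representsClass_boundary (singHomotopyOp m X z)).smul (-1))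

theorem RepresentsClass.iterate_subdiv {z : SingChain m X} {h : HomologyC m X}
    (hz : RepresentsClass z h) (N : ℕ) : RepresentsClass ((singSubdiv m X)^[N] z) h := by
  induction N with
  | zero => exact hz
  | succ N ih => rw [Function.iterate_succ_apply']; exact ih.subdiv

theorem iterate_singSubdiv_realizeChain (σ : C(stdSimplex ℝ (Fin (m + 1)), X)) (N : ℕ)
    (c : TupleChain (k + 1) (stdSimplex ℝ (Fin (m + 1)))) :
    (singSubdiv k X)^[N] (realizeChain k σ c) =
      realizeChain k σ ((TupleChain.subdiv baryPoint (k + 1))^[N] c) := by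
  induction N with
  | zero => rfl
  | succ N ih => rw [Function.iterate_succ_apply', Function.iterate_succ_apply', ih,
      singSubdiv_realizeChain]

/-- The singular simplices that lie in one of two sets. -/
def smallSimplices (m : ℕ) (U V : Set X) : Set C(stdSimplex ℝ (Fin (m + 1)), X) :=
  {σ | Set.range σ ⊆ U ∨ Set.range σ ⊆ V}

/-- The diameters shrink geometrically, eventually below a Lebesgue number of the pulled back cover.
The bound is stated for all large `N`, so that a sum of chains can use a common one. -/
theorem exists_iterate_singSubdiv_single_mem {U V : Set X} (hU : IsOpen U) (hV : IsOpen V)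
    (hUV : U ∪ V = Set.univ) (σ : C(stdSimplex ℝ (Fin (m + 1)), X)) :
    ∃ N₀, ∀ N, N₀ ≤ N → (singSubdiv m X)^[N] (Finsupp.single σ 1) ∈
      Finsupp.supported ℂ ℂ (smallSimplices m U V) := by
  obtain ⟨δ, hδ, hball⟩ := lebesgue_number_lemma_of_metric
    (s := (Set.univ : Set (stdSimplex ℝ (Fin (m + 1))))) (ι := Bool)
    (c := fun b => σ ⁻¹' (cond b U V)) isCompact_univ
    (fun b => by cases b; exacts [hV.preimage σ.continuous, hU.preimage σ.continuous])
    (fun x _ => by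
      rcases (hUV ▸ Set.mem_univ (σ x) : σ x ∈ U ∪ V) with h | h
      · exact Set.mem_iUnion.2 ⟨true, h⟩
      · exact Set.mem_iUnion.2 ⟨false, h⟩)
  set ρ : ℝ := m / (m + 1)
  set D : ℝ := Metric.diam (Set.univ : Set (stdSimplex ℝ (Fin (m + 1))))
  have hρ0 : 0 ≤ ρ := by positivity
  have hρ1 : ρ < 1 := (div_lt_one (by positivity)).2 (by linarith)
  have hlim : Filter.Tendsto (fun N : ℕ => ρ ^ N * D) Filter.atTop (nhds 0) := by
    simpa using (tendsto_pow_atTop_nhds_zero_of_lt_one hρ0 hρ1).mul_const D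
  obtain ⟨N₀, hN₀⟩ := Filter.eventually_atTop.1 (hlim.eventually (gt_mem_nhds hδ))
  refine ⟨N₀, fun N hN => ?_⟩
  have hmem := TupleChain.iterate_subdiv_mem (β := baryPoint) hρ0
    (fun k v x r => dist_affineSimplex_le v _ x)
    -- Faces of dimension j ≤ m contract by j/(j+1), which is at most the factor m/(m+1) used
    -- throughout.
    (fun j (hj : j < m + 1) v D' hv i => (dist_baryPoint_le v hv i).trans (by
      have hD' : 0 ≤ D' := dist_nonneg.trans (hv 0 0)
      refine mul_le_mul_of_nonneg_right ?_ hD'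
      rw [div_le_div_iff₀ (by positivity) (by positivity)]
      have : (j : ℝ) ≤ m := by exact_mod_cast Nat.lt_succ_iff.1 hj
      linarith))
    (stdSimplex.vertex : Fin (m + 1) → stdSimplex ℝ (Fin (m + 1))) (D := D) Metric.diam_nonneg
    (fun i j => Metric.dist_le_diam_of_mem isCompact_univ.isBounded trivial trivial) N
  rw [← realizeChain_vertexChain, iterate_singSubdiv_realizeChain]
  refine map_mem_of_mem_supported _ (fun w hw => ?_) hmem
  rw [realizeChain_single]
  refine Finsupp.single_mem_supported _ _ ?_
  obtain ⟨b, hb⟩ := hball (w 0) trivial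
  have hrange : Set.range (σ.comp (affineSimplex w)) ⊆ cond b U V := by
    rintro _ ⟨t, rfl⟩
    refine hb (Metric.mem_ball.2 ((dist_affineSimplex_le w t (w 0) fun i => hw i 0).trans_lt ?_))
    exact hN₀ N hN
  cases b
  · exact Or.inr hrange
  · exact Or.inl hrange

theorem exists_iterate_singSubdiv_mem {U V : Set X} (hU : IsOpen U) (hV : IsOpen V)
    (hUV : U ∪ V = Set.univ) (z : SingChain m X) :
    ∃ N₀, ∀ N, N₀ ≤ N → (singSubdiv m X)^[N] z ∈
      Finsupp.supported ℂ ℂ (smallSimplices m U V) := by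
  induction z using Finsupp.induction_linear with
  | zero => exact ⟨0, fun N _ => by rw [← Module.End.coe_pow, map_zero]; exact zero_mem _⟩
  | add x y hx hy =>
    obtain ⟨N₁, h₁⟩ := hx
    obtain ⟨N₂, h₂⟩ := hy
    refine ⟨max N₁ N₂, fun N hN => ?_⟩
    have h₁' := h₁ N (le_of_max_le_left hN)
    have h₂' := h₂ N (le_of_max_le_right hN)
    rw [← Module.End.coe_pow] at h₁' h₂' ⊢
    rw [map_add]
    exact add_mem h₁' h₂'
  | single σ c =>
    obtain ⟨N₀, h⟩ := exists_iterate_singSubdiv_single_mem hU hV hUV σ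
    refine ⟨N₀, fun N hN => ?_⟩
    have h' := h N hN
    rw [← Module.End.coe_pow] at h' ⊢
    rw [← mul_one c, ← smul_eq_mul, ← Finsupp.smul_single, map_smul]
    exact Submodule.smul_mem _ _ h'

/-- Every homology class is represented by a chain of small simplices. -/
theorem exists_small_representsClass {U V : Set X} (hU : IsOpen U) (hV : IsOpen V)
    (hUV : U ∪ V = Set.univ) (h : HomologyC m X) :
    ∃ z, RepresentsClass z h ∧ z ∈ Finsupp.supported ℂ ℂ (smallSimplices m U V) := by
  obtain ⟨z, hz⟩ := exists_representsClass h
  obtain ⟨N, hN⟩ := exists_iterate_singSubdiv_mem hU hV hUV z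
  exact ⟨_, hz.iterate_subdiv N, hN N le_rfl⟩

end Subdivision

/-! ### Functoriality, homotopy invariance and inclusions -/

section Functoriality

variable {X Y Z : Type} [TopologicalSpace X] [TopologicalSpace Y] [TopologicalSpace Z] (m : ℕ)

theorem homologyCMap_comp (g : C(Y, Z)) (f : C(X, Y)) (h : HomologyC m X) :
    homologyCMap m (g.comp f) h = homologyCMap m g (homologyCMap m f h) := by
  have := (((AlgebraicTopology.singularHomologyFunctor (ModuleCat.{0} ℂ) m).obj
    (ModuleCat.of ℂ ℂ))).map_comp (TopCat.ofHom f) (TopCat.ofHom g)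
  exact congrArg (fun f => (ModuleCat.Hom.hom f) h) this

theorem homologyCMap_id (h : HomologyC m X) : homologyCMap m (ContinuousMap.id X) h = h := by
  have := (((AlgebraicTopology.singularHomologyFunctor (ModuleCat.{0} ℂ) m).obj
    (ModuleCat.of ℂ ℂ))).map_id (TopCat.of X)
  exact congrArg (fun f => (ModuleCat.Hom.hom f) h) this

theorem homologyCMap_eq_of_homotopic {f g : C(X, Y)} (H : f.Homotopic g) :
    homologyCMap m f = homologyCMap m g := by
  obtain ⟨H⟩ := H
  have := TopCat.Homotopy.congr_homologyMap_singularChainComplexFunctor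
    (f := TopCat.ofHom f) (g := TopCat.ofHom g) H (ModuleCat.of ℂ ℂ) m
  exact congrArg ModuleCat.Hom.hom this

theorem homologyCMap_eq_of_comp_eq {W : Type} [TopologicalSpace W] {f : C(X, Y)} {g : C(Y, Z)}
    {f' : C(X, W)} {g' : C(W, Z)} (e : g.comp f = g'.comp f') (h : HomologyC m X) :
    homologyCMap m g (homologyCMap m f h) = homologyCMap m g' (homologyCMap m f' h) := by
  rw [← homologyCMap_comp, e, homologyCMap_comp]

theorem homologyC_eq_zero_of_isEmpty [IsEmpty X] (h : HomologyC m X) : h = 0 := by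
  obtain ⟨z, hz⟩ := exists_representsClass h
  have : IsEmpty C(stdSimplex ℝ (Fin (m + 1)), X) :=
    ⟨fun σ => IsEmpty.false (σ stdSimplex.barycenter)⟩
  have h0 : z = singBoundary m X 0 := Subsingleton.elim _ _
  exact (h0 ▸ hz).unique (representsClass_boundary 0)

end Functoriality

section SetInclusion

variable {M : Type} [TopologicalSpace M]

/-- The inclusion of a subset in a larger one. -/
def setIncl {A B : Set M} (h : A ⊆ B) : C(A, B) := ⟨Set.inclusion h, continuous_inclusion h⟩

/-- The inclusion of a subset in the whole space. -/
def valMap (A : Set M) : C(A, M) := ⟨Subtype.val, continuous_subtype_val⟩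

theorem setIncl_comp_setIncl {A B C : Set M} (h : A ⊆ B) (h' : B ⊆ C) :
    (setIncl h').comp (setIncl h) = setIncl (h.trans h') := rfl

theorem valMap_comp_setIncl {A B : Set M} (h : A ⊆ B) :
    (valMap B).comp (setIncl h) = valMap A := rfl

theorem homologyCMap_setIncl_setIncl (m : ℕ) {A B C : Set M} (h : A ⊆ B) (h' : B ⊆ C)
    (x : HomologyC m A) : homologyCMap m (setIncl h') (homologyCMap m (setIncl h) x) =
      homologyCMap m (setIncl (h.trans h')) x := by
  rw [← homologyCMap_comp, setIncl_comp_setIncl]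

theorem homologyCMap_valMap_setIncl (m : ℕ) {A B : Set M} (h : A ⊆ B) (x : HomologyC m A) :
    homologyCMap m (valMap B) (homologyCMap m (setIncl h) x) = homologyCMap m (valMap A) x := by
  rw [← homologyCMap_comp, valMap_comp_setIncl]

end SetInclusion

/-! ### Pushing chains forward and restricting their supports -/

section Push

variable {X Y Z : Type} [TopologicalSpace X] [TopologicalSpace Y] [TopologicalSpace Z] {m : ℕ}

theorem singPush_single (f : C(X, Y)) (σ : C(stdSimplex ℝ (Fin (m + 1)), X)) (c : ℂ) :
    singPush m f (Finsupp.single σ c) = Finsupp.single (f.comp σ) c := by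
  simp [singPush]

theorem singPush_comp (g : C(Y, Z)) (f : C(X, Y)) (z : SingChain m X) :
    singPush m g (singPush m f z) = singPush m (g.comp f) z := by
  induction z using Finsupp.induction_linear with
  | zero => simp
  | add x y hx hy => simp only [map_add, hx, hy]
  | single σ c => simp only [singPush_single, ContinuousMap.comp_assoc]

theorem singPush_injective {f : C(X, Y)} (hf : Function.Injective f) :
    Function.Injective (singPush m f) :=
  Finsupp.mapDomain_injective fun _ _ h => ContinuousMap.ext fun x => hf (DFunLike.congr_fun h x)

theorem singBoundary_singPush (f : C(X, Y)) (z : SingChain (m + 1) X) :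
    singBoundary m Y (singPush (m + 1) f z) = singPush m f (singBoundary m X z) := by
  suffices h : singBoundary m Y ∘ₗ singPush (m + 1) f = singPush m f ∘ₗ singBoundary m X from
    LinearMap.congr_fun h z
  refine Finsupp.lhom_ext' fun σ => LinearMap.ext_ring ?_
  simp only [LinearMap.comp_apply, Finsupp.lsingle_apply, singPush_single, singBoundary,
    Finsupp.linearCombination_single, one_smul, map_sum, map_smul, ContinuousMap.comp_assoc]

theorem singPush_mem_supported (f : C(X, Y)) (z : SingChain m X) :
    singPush m f z ∈ Finsupp.supported ℂ ℂ
      {σ : C(stdSimplex ℝ (Fin (m + 1)), Y) | Set.range σ ⊆ Set.range f} := by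
  induction z using Finsupp.induction_linear with
  | zero => simp
  | add x y hx hy => rw [map_add]; exact add_mem hx hy
  | single σ c =>
    rw [singPush_single]
    exact Finsupp.single_mem_supported _ _ (Set.range_comp_subset_range σ f)

theorem exists_singPush_eq {f : C(X, Y)} (hf : Topology.IsEmbedding f) {z : SingChain m Y}
    (hz : z ∈ Finsupp.supported ℂ ℂ
      {σ : C(stdSimplex ℝ (Fin (m + 1)), Y) | Set.range σ ⊆ Set.range f}) :
    ∃ y, singPush m f y = z := by
  refine (map_mem_of_mem_supported (P := LinearMap.range (singPush m f)) LinearMap.id ?_ hz :)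
  intro σ hσ
  choose g hg using fun x => hσ (Set.mem_range_self x)
  refine ⟨Finsupp.single ⟨g, hf.continuous_iff.2 ?_⟩ 1, ?_⟩
  · have : ⇑f ∘ g = σ := funext hg
    rw [this]
    exact σ.continuous
  · rw [singPush_single]
    exact congrArg (fun τ => Finsupp.single τ (1 : ℂ)) (ContinuousMap.ext hg)

end Push

/-! ### The Mayer–Vietoris relation -/

section MayerVietoris

variable {M : Type} [TopologicalSpace M] {m : ℕ}

theorem range_setIncl {A B : Set M} (h : A ⊆ B) : Set.range (setIncl h) = Subtype.val ⁻¹' A := by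
  ext x
  exact ⟨by rintro ⟨y, rfl⟩; exact y.2, fun hx => ⟨⟨x.1, hx⟩, rfl⟩⟩

theorem isEmbedding_setIncl {A B : Set M} (h : A ⊆ B) : Topology.IsEmbedding (setIncl h) :=
  Topology.IsEmbedding.inclusion h

theorem setIncl_injective {A B : Set M} (h : A ⊆ B) : Function.Injective (setIncl h) :=
  Set.inclusion_injective h

/-- Every homology class of a union of two open sets is represented by a sum of chains in the
two sets. -/
theorem exists_represents_add {A B : Set M} (hA : IsOpen A) (hB : IsOpen B)
    (z : HomologyC m ↥(A ∪ B)) : ∃ (u : SingChain m A) (v : SingChain m B),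
      RepresentsClass (singPush m (setIncl Set.subset_union_left) u +
        singPush m (setIncl Set.subset_union_right) v) z := by
  obtain ⟨c, hc, hs⟩ := exists_small_representsClass
    (U := (Subtype.val ⁻¹' A : Set ↥(A ∪ B))) (V := Subtype.val ⁻¹' B)
    (hA.preimage continuous_subtype_val) (hB.preimage continuous_subtype_val)
    (Set.eq_univ_of_forall fun x => x.2) z
  have hs' : smallSimplices m (Subtype.val ⁻¹' A : Set ↥(A ∪ B)) (Subtype.val ⁻¹' B) =
      {σ : C(stdSimplex ℝ (Fin (m + 1)), ↥(A ∪ B)) |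
        Set.range σ ⊆ Set.range (setIncl (Set.subset_union_left (s := A) (t := B)))} ∪
      {σ : C(stdSimplex ℝ (Fin (m + 1)), ↥(A ∪ B)) |
        Set.range σ ⊆ Set.range (setIncl (Set.subset_union_right (s := A) (t := B)))} := by
    rw [range_setIncl, range_setIncl]
    rfl
  rw [hs', Finsupp.supported_union] at hs
  obtain ⟨a, ha, b, hb, rfl⟩ := Submodule.mem_sup.1 hs
  obtain ⟨u, rfl⟩ := exists_singPush_eq (isEmbedding_setIncl _) ha
  obtain ⟨v, rfl⟩ := exists_singPush_eq (isEmbedding_setIncl _) hb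
  exact ⟨u, v, hc⟩

/-- A class `w` of the intersection is a Mayer–Vietoris boundary of the class `z` of the union:
`z` is represented by a sum of chains in the two sets and `w` by the boundary of the second. -/
def MVRel (A B : Set M) (z : HomologyC (m + 1) ↥(A ∪ B)) (w : HomologyC m ↥(A ∩ B)) : Prop :=
  ∃ (u : SingChain (m + 1) A) (v : SingChain (m + 1) B) (t : SingChain m ↥(A ∩ B)),
    RepresentsClass (singPush (m + 1) (setIncl Set.subset_union_left) u +
      singPush (m + 1) (setIncl Set.subset_union_right) v) z ∧ RepresentsClass t w ∧
    singBoundary m A u = -singPush m (setIncl Set.inter_subset_left) t ∧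
    singBoundary m B v = singPush m (setIncl Set.inter_subset_right) t

variable {A B A' B' : Set M}

theorem singBoundary_singBoundary {X : Type} [TopologicalSpace X] (z : SingChain (m + 2) X) :
    singBoundary m X (singBoundary (m + 1) X z) = 0 :=
  (representsClass_boundary z).boundary_eq_zero

theorem exists_class_of_push_boundary {X Y : Type} [TopologicalSpace X] [TopologicalSpace Y]
    {f : C(X, Y)} (hf : Function.Injective f) {t : SingChain m X} {v : SingChain (m + 1) Y}
    (h : singBoundary m Y v = singPush m f t) : ∃ w, RepresentsClass t w := by
  cases m with
  | zero => exact exists_class_zero t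
  | succ m =>
    refine exists_class_of_boundary_eq_zero (singPush_injective (m := m) hf ?_)
    rw [← singBoundary_singPush, ← h, singBoundary_singBoundary, map_zero]

/-- For a cycle u + v the chains ∂v = -∂u are supported in both sets, hence in the intersection. -/
theorem exists_mvRel (hA : IsOpen A) (hB : IsOpen B) (z : HomologyC (m + 1) ↥(A ∪ B)) :
    ∃ w, MVRel A B z w := by
  obtain ⟨u, v, huv⟩ := exists_represents_add hA hB z
  have h0 := huv.boundary_eq_zero
  rw [map_add, singBoundary_singPush, singBoundary_singPush, add_eq_zero_iff_eq_neg'] at h0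
  have hu := singPush_mem_supported (setIncl (Set.subset_union_left (s := A) (t := B)))
    (singBoundary m A u)
  have hv := singPush_mem_supported (setIncl (Set.subset_union_right (s := A) (t := B)))
    (singBoundary m B v)
  have hu' := neg_mem hu
  rw [← h0] at hu'
  have hint := Submodule.mem_inf.2 ⟨hu', hv⟩
  rw [← Finsupp.supported_inter] at hint
  have hI : A ∩ B ⊆ A ∪ B := Set.inter_subset_left.trans Set.subset_union_left
  obtain ⟨t, ht⟩ := exists_singPush_eq (isEmbedding_setIncl hI)
    (Finsupp.supported_mono (fun σ hσ => by
      rw [range_setIncl, range_setIncl] at hσ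
      simp only [Set.mem_ofPred_eq, range_setIncl]
      exact fun x hx => ⟨hσ.1 hx, hσ.2 hx⟩) hint)
  have hbv : singBoundary m B v = singPush m (setIncl Set.inter_subset_right) t := by
    apply singPush_injective (setIncl_injective Set.subset_union_right)
    rw [singPush_comp, setIncl_comp_setIncl, ht]
  have hbu : singBoundary m A u = -singPush m (setIncl Set.inter_subset_left) t := by
    apply singPush_injective (setIncl_injective Set.subset_union_left)
    rw [map_neg, singPush_comp, setIncl_comp_setIncl, ht, h0, neg_neg]
  obtain ⟨w, hw⟩ := exists_class_of_push_boundary (setIncl_injective _) hbv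
  exact ⟨w, u, v, t, huv, hw, hbu, hbv⟩

theorem MVRel.add {z z' : HomologyC (m + 1) ↥(A ∪ B)} {w w' : HomologyC m ↥(A ∩ B)}
    (h : MVRel A B z w) (h' : MVRel A B z' w') : MVRel A B (z + z') (w + w') := by
  obtain ⟨u, v, t, h1, h2, h3, h4⟩ := h
  obtain ⟨u', v', t', h1', h2', h3', h4'⟩ := h'
  refine ⟨u + u', v + v', t + t', ?_, h2.add h2', ?_, ?_⟩
  · rw [map_add, map_add, add_add_add_comm]
    exact h1.add h1'
  · rw [map_add, map_add, h3, h3', neg_add]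
  · rw [map_add, map_add, h4, h4']

theorem MVRel.smul {z : HomologyC (m + 1) ↥(A ∪ B)} {w : HomologyC m ↥(A ∩ B)} (c : ℂ)
    (h : MVRel A B z w) : MVRel A B (c • z) (c • w) := by
  obtain ⟨u, v, t, h1, h2, h3, h4⟩ := h
  refine ⟨c • u, c • v, c • t, ?_, h2.smul c, ?_, ?_⟩
  · rw [map_smul, map_smul, ← smul_add]
    exact h1.smul c
  · rw [map_smul, map_smul, h3, smul_neg]
  · rw [map_smul, map_smul, h4]

theorem MVRel.map_right_eq_zero {z : HomologyC (m + 1) ↥(A ∪ B)} {w : HomologyC m ↥(A ∩ B)}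
    (h : MVRel A B z w) : homologyCMap m (setIncl Set.inter_subset_right) w = 0 := by
  obtain ⟨u, v, t, h1, h2, h3, h4⟩ := h
  have h5 := h2.push (setIncl (Set.inter_subset_right (s := A) (t := B)))
  rw [← h4] at h5
  exact h5.unique (representsClass_boundary _)

/-- If t = ∂y in the intersection, then u + y and v - y are cycles with the same sum as u and v. -/
theorem MVRel.exists_add {z : HomologyC (m + 1) ↥(A ∪ B)} (h : MVRel A B z 0) :
    ∃ (a : HomologyC (m + 1) A) (b : HomologyC (m + 1) B),
      z = homologyCMap (m + 1) (setIncl Set.subset_union_left) a +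
        homologyCMap (m + 1) (setIncl Set.subset_union_right) b := by
  obtain ⟨u, v, t, h1, h2, h3, h4⟩ := h
  obtain ⟨y, hy⟩ := h2.exists_boundary
  obtain ⟨a, ha⟩ := exists_class_of_boundary_eq_zero
    (z := u + singPush (m + 1) (setIncl Set.inter_subset_left) y) (by
      rw [map_add, singBoundary_singPush, hy, h3, neg_add_cancel])
  obtain ⟨b, hb⟩ := exists_class_of_boundary_eq_zero
    (z := v - singPush (m + 1) (setIncl Set.inter_subset_right) y) (by
      rw [map_sub, singBoundary_singPush, hy, h4, sub_self])
  refine ⟨a, b, h1.unique ?_⟩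
  have hab := (ha.push (setIncl (Set.subset_union_left (s := A) (t := B)))).add
    (hb.push (setIncl (Set.subset_union_right (s := A) (t := B))))
  rw [map_add, map_sub, singPush_comp, singPush_comp, setIncl_comp_setIncl,
    setIncl_comp_setIncl, add_add_sub_cancel] at hab
  exact hab

theorem MVRel.mono (hA : A ⊆ A') (hB : B ⊆ B') {z : HomologyC (m + 1) ↥(A ∪ B)}
    {w : HomologyC m ↥(A ∩ B)} (h : MVRel A B z w) :
    MVRel A' B' (homologyCMap (m + 1) (setIncl (Set.union_subset_union hA hB)) z)
      (homologyCMap m (setIncl (Set.inter_subset_inter hA hB)) w) := by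
  obtain ⟨u, v, t, h1, h2, h3, h4⟩ := h
  refine ⟨singPush (m + 1) (setIncl hA) u, singPush (m + 1) (setIncl hB) v,
    singPush m (setIncl (Set.inter_subset_inter hA hB)) t, ?_, h2.push _, ?_, ?_⟩
  · have := h1.push (setIncl (Set.union_subset_union hA hB))
    rw [map_add, singPush_comp, singPush_comp, setIncl_comp_setIncl, setIncl_comp_setIncl] at this
    rw [singPush_comp, singPush_comp, setIncl_comp_setIncl, setIncl_comp_setIncl]
    exact this
  · rw [singBoundary_singPush, h3, map_neg, singPush_comp, singPush_comp, setIncl_comp_setIncl,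
      setIncl_comp_setIncl]
  · rw [singBoundary_singPush, h4, singPush_comp, singPush_comp, setIncl_comp_setIncl,
      setIncl_comp_setIncl]

theorem exists_add_of_degree_zero (hA : IsOpen A) (hB : IsOpen B) (z : HomologyC 0 ↥(A ∪ B)) :
    ∃ (a : HomologyC 0 A) (b : HomologyC 0 B),
      z = homologyCMap 0 (setIncl Set.subset_union_left) a +
        homologyCMap 0 (setIncl Set.subset_union_right) b := by
  obtain ⟨u, v, huv⟩ := exists_represents_add hA hB z
  obtain ⟨a, ha⟩ := exists_class_zero u
  obtain ⟨b, hb⟩ := exists_class_zero v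
  exact ⟨a, b, huv.unique ((ha.push _).add (hb.push _))⟩

end MayerVietoris

/-! ### Sliding along great circles -/

section Slide

/-- The inner product of two points of the sphere. -/
def sphereInner (p q : S2) : ℝ := inner ℝ (p : EuclideanSpace ℝ (Fin 3)) q

theorem sphereInner_self (p : S2) : sphereInner p p = 1 := by
  have h : ‖(p : EuclideanSpace ℝ (Fin 3))‖ = 1 := mem_sphere_zero_iff_norm.1 p.2
  rw [sphereInner, real_inner_self_eq_norm_sq, h, one_pow]

theorem sphereInner_neg_right (p q : S2) : sphereInner p (-q) = -sphereInner p q := by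
  simp [sphereInner]

theorem sphereInner_le_one (p q : S2) : sphereInner p q ≤ 1 := by
  have hp : ‖(p : EuclideanSpace ℝ (Fin 3))‖ = 1 := mem_sphere_zero_iff_norm.1 p.2
  have hq : ‖(q : EuclideanSpace ℝ (Fin 3))‖ = 1 := mem_sphere_zero_iff_norm.1 q.2
  have := real_inner_le_norm (p : EuclideanSpace ℝ (Fin 3)) q
  rwa [hp, hq, mul_one] at this

theorem sphereInner_eq_one_iff {p q : S2} : sphereInner p q = 1 ↔ p = q := by
  have hp : ‖(p : EuclideanSpace ℝ (Fin 3))‖ = 1 := mem_sphere_zero_iff_norm.1 p.2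
  have hq : ‖(q : EuclideanSpace ℝ (Fin 3))‖ = 1 := mem_sphere_zero_iff_norm.1 q.2
  rw [sphereInner, inner_eq_one_iff_of_norm_eq_one hp hq, Subtype.ext_iff]

@[fun_prop]
theorem Continuous.sphereInner {X : Type*} [TopologicalSpace X] {f g : X → S2} (hf : Continuous f)
    (hg : Continuous g) : Continuous fun x => sphereInner (f x) (g x) :=
  (continuous_subtype_val.comp hf).inner (continuous_subtype_val.comp hg)

/-- The point of the segment from `p` to `q` with parameter `s`. -/
def slideVec (s : ℝ) (p q : S2) : EuclideanSpace ℝ (Fin 3) :=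
  (1 - s) • (p : EuclideanSpace ℝ (Fin 3)) + s • (q : EuclideanSpace ℝ (Fin 3))

open Classical in
/-- The radial projection to the sphere of the segment from `p` to `q`. -/
def slide (s : ℝ) (p q : S2) : S2 :=
  if h : slideVec s p q = 0 then p else
    ⟨‖slideVec s p q‖⁻¹ • slideVec s p q, by
      rw [mem_sphere_zero_iff_norm, norm_smul, norm_inv, norm_norm,
        inv_mul_cancel₀ (norm_ne_zero_iff.2 h)]⟩

theorem slide_coe {s : ℝ} {p q : S2} (h : slideVec s p q ≠ 0) :
    (slide s p q : EuclideanSpace ℝ (Fin 3)) = ‖slideVec s p q‖⁻¹ • slideVec s p q := by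
  rw [slide, dif_neg h]

theorem slide_eq_of_slideVec_eq {s : ℝ} {p q r : S2} (h : slideVec s p q = r) :
    slide s p q = r := by
  have hr : ‖(r : EuclideanSpace ℝ (Fin 3))‖ = 1 := mem_sphere_zero_iff_norm.1 r.2
  apply Subtype.ext
  rw [slide_coe, h, hr, inv_one, one_smul]
  rw [h, ← norm_ne_zero_iff, hr]
  exact one_ne_zero

@[simp]
theorem slide_zero (p q : S2) : slide 0 p q = p := slide_eq_of_slideVec_eq (by simp [slideVec])

@[simp]
theorem slide_one (p q : S2) : slide 1 p q = q := slide_eq_of_slideVec_eq (by simp [slideVec])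

@[simp]
theorem slide_self (s : ℝ) (p : S2) : slide s p p = p :=
  slide_eq_of_slideVec_eq (by rw [slideVec, ← add_smul]; simp)

theorem norm_slideVec_sq (s : ℝ) (p q : S2) :
    ‖slideVec s p q‖ ^ 2 = (1 - s) ^ 2 + s ^ 2 + 2 * s * (1 - s) * sphereInner p q := by
  have hp : ‖(p : EuclideanSpace ℝ (Fin 3))‖ = 1 := mem_sphere_zero_iff_norm.1 p.2
  have hq : ‖(q : EuclideanSpace ℝ (Fin 3))‖ = 1 := mem_sphere_zero_iff_norm.1 q.2
  rw [slideVec, norm_add_sq_real, norm_smul, norm_smul, hp, hq, real_inner_smul_left,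
    real_inner_smul_right, mul_one, mul_one, Real.norm_eq_abs, Real.norm_eq_abs, sq_abs, sq_abs,
    sphereInner]
  ring

theorem slideVec_ne_zero {s : ℝ} (h0 : 0 ≤ s) (h1 : s ≤ 1) {p q : S2} (h : -1 < sphereInner p q) :
    slideVec s p q ≠ 0 := by
  intro h'
  have := norm_slideVec_sq s p q
  rw [h', norm_zero] at this
  rcases h0.eq_or_lt with rfl | h0
  · norm_num at this
  rcases h1.eq_or_lt with rfl | h1
  · norm_num at this
  have h2 : 0 < s * (1 - s) * (1 + sphereInner p q) :=
    mul_pos (mul_pos h0 (by linarith)) (by linarith)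
  nlinarith [sq_nonneg (1 - 2 * s)]

/-- Moving towards `q` never increases the distance to `q`. With c the inner product and N the norm
of the chord point, the claim is N c ≤ (1-s)c + s. This monotonicity keeps the homotopies below
inside caps, `nearSet` and `tubeSet`. -/
theorem le_sphereInner_slide {s : ℝ} (h0 : 0 ≤ s) (h1 : s ≤ 1) {p q : S2}
    (h : -1 < sphereInner p q) : sphereInner p q ≤ sphereInner (slide s p q) q := by
  have hv := slideVec_ne_zero h0 h1 h
  have hpos : 0 < ‖slideVec s p q‖ := norm_pos_iff.2 hv
  have hq : ‖(q : EuclideanSpace ℝ (Fin 3))‖ = 1 := mem_sphere_zero_iff_norm.1 q.2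
  have hin : sphereInner (slide s p q) q =
      ‖slideVec s p q‖⁻¹ * ((1 - s) * sphereInner p q + s) := by
    rw [sphereInner, slide_coe hv, real_inner_smul_left]
    congr 1
    rw [slideVec, inner_add_left, real_inner_smul_left, real_inner_smul_left,
      real_inner_self_eq_norm_sq, hq, sphereInner]
    ring
  rw [hin, inv_mul_eq_div, le_div_iff₀ hpos]
  have hn := norm_slideVec_sq s p q
  set c := sphereInner p q
  set N := ‖slideVec s p q‖
  have hc : c ≤ 1 := sphereInner_le_one p q
  have hs : 0 ≤ s * (1 - s) := mul_nonneg h0 (by linarith)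
  have hN : N ≤ 1 := by
    have : N ^ 2 ≤ 1 := by nlinarith
    nlinarith
  rcases le_or_gt 0 c with hc0 | hc0
  · nlinarith [mul_nonneg h0 (sub_nonneg.2 hc), mul_nonneg hc0 (sub_nonneg.2 hN)]
  rcases le_or_gt 0 ((1 - s) * c + s) with h2 | h2
  · nlinarith [mul_pos hpos (neg_pos.2 hc0)]
  -- Both sides of the claim are negative, so squares are compared. Substituting N², the difference
  -- of squares is s(1-c²)·(-(s+2(1-s)c)), which is nonnegative here.
  · have h3 : (-((1 - s) * c + s)) ^ 2 ≤ (-c * N) ^ 2 := by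
      have h4 : s + 2 * (1 - s) * c ≤ 0 := by nlinarith [mul_nonneg (sub_nonneg.2 h1) (neg_nonneg.2 hc0.le)]
      have h5 : 0 ≤ s * ((1 - c ^ 2) * -(s + 2 * (1 - s) * c)) :=
        mul_nonneg h0 (mul_nonneg (by nlinarith) (by linarith))
      rw [mul_pow, hn]
      nlinarith
    have h6 := (le_abs_self _).trans (abs_le_of_sq_le_sq h3 (mul_nonneg (by linarith) hpos.le))
    linarith

theorem continuousOn_slide : ContinuousOn (fun x : ℝ × S2 × S2 => slide x.1 x.2.1 x.2.2)
    {x | slideVec x.1 x.2.1 x.2.2 ≠ 0} := by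
  rw [Topology.IsInducing.subtypeVal.continuousOn_iff]
  have hc : Continuous fun x : ℝ × S2 × S2 => slideVec x.1 x.2.1 x.2.2 := by
    unfold slideVec
    fun_prop
  refine ContinuousOn.congr (f := fun x : ℝ × S2 × S2 =>
    ‖slideVec x.1 x.2.1 x.2.2‖⁻¹ • slideVec x.1 x.2.1 x.2.2) ?_ fun x hx => slide_coe hx
  exact (hc.norm.continuousOn.inv₀ fun x hx => norm_ne_zero_iff.2 hx).smul hc.continuousOn

theorem continuous_slide {X : Type*} [TopologicalSpace X] {s : X → ℝ} {p q : X → S2}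
    (hs : Continuous s) (hp : Continuous p) (hq : Continuous q)
    (h : ∀ x, slideVec (s x) (p x) (q x) ≠ 0) : Continuous fun x => slide (s x) (p x) (q x) :=
  continuousOn_slide.comp_continuous (hs.prodMk (hp.prodMk hq)) h

end Slide

theorem homologyCMap_eq_of_homotopy {X Y : Type} [TopologicalSpace X] [TopologicalSpace Y] (m : ℕ)
    {f g : C(X, Y)} (F : unitInterval × X → Y) (hF : Continuous F) (h0 : ∀ x, F (0, x) = f x)
    (h1 : ∀ x, F (1, x) = g x) : homologyCMap m f = homologyCMap m g :=
  homologyCMap_eq_of_homotopic m ⟨⟨⟨F, hF⟩, h0, h1⟩⟩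

/-! ### Neighbourhoods of forests of diagonals -/

section Forest

variable {n : ℕ}

/-- The configurations in which some point `x t`, with `t ∈ T`, is close to `x (π t)`. -/
def nearSet (π : Fin n → Fin n) (c : ℝ) (T : Finset (Fin n)) : Set (Fin n → S2) :=
  {x | ∃ t ∈ T, c < sphereInner (x t) (x (π t))}

theorem isOpen_nearSet (π : Fin n → Fin n) (c : ℝ) (T : Finset (Fin n)) :
    IsOpen (nearSet π c T) := by
  have : nearSet π c T = ⋃ t ∈ T, {x | c < sphereInner (x t) (x (π t))} := by
    ext x
    simp [nearSet]
  rw [this]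
  exact isOpen_biUnion fun t _ => isOpen_lt continuous_const (by fun_prop)

/-- Moves the coordinate `e` to the coordinate `e'`. -/
def moveCoord (e e' : Fin n) (s : ℝ) (x : Fin n → S2) : Fin n → S2 :=
  Function.update x e (slide s (x e) (x e'))

theorem continuous_moveCoord_one (e e' : Fin n) : Continuous (moveCoord e e' 1) := by
  have : moveCoord e e' 1 = fun x : Fin n → S2 => Function.update x e (x e') := by
    funext x
    simp [moveCoord]
  rw [this]
  fun_prop

theorem moveCoord_zero (e e' : Fin n) (x : Fin n → S2) : moveCoord e e' 0 x = x := by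
  simp [moveCoord]

/-- The conditions for `T` involve only coordinates below `e`, which do not move. This is where the
forest structure enters. -/
theorem moveCoord_mem_nearSet {π : Fin n → Fin n} {c : ℝ} {T : Finset (Fin n)} {e e' : Fin n}
    (hT : ∀ t ∈ T, π t < t) (he : ∀ t ∈ T, t < e) (s : ℝ) {x : Fin n → S2}
    (hx : x ∈ nearSet π c T) : moveCoord e e' s x ∈ nearSet π c T := by
  obtain ⟨t, ht, h⟩ := hx
  refine ⟨t, ht, ?_⟩
  rwa [moveCoord, Function.update_of_ne (he t ht).ne,
    Function.update_of_ne ((hT t ht).trans (he t ht)).ne]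

theorem moveCoord_mem_nearSet_singleton {π : Fin n → Fin n} {c : ℝ} (hc : -1 ≤ c) {e : Fin n}
    (he : π e < e) {s : ℝ} (h0 : 0 ≤ s) (h1 : s ≤ 1) {x : Fin n → S2}
    (hx : x ∈ nearSet π c {e}) : moveCoord e (π e) s x ∈ nearSet π c {e} := by
  obtain ⟨t, ht, h⟩ := hx
  obtain rfl := Finset.mem_singleton.1 ht
  refine ⟨t, ht, ?_⟩
  rw [moveCoord, Function.update_self, Function.update_of_ne he.ne]
  exact h.trans_le (le_sphereInner_slide h0 h1 (hc.trans_lt h))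

theorem moveCoord_one_mem_nearSet_singleton {π : Fin n → Fin n} {c : ℝ} (hc : c < 1) {e : Fin n}
    (he : π e < e) (x : Fin n → S2) : moveCoord e (π e) 1 x ∈ nearSet π c {e} := by
  refine ⟨e, Finset.mem_singleton_self e, ?_⟩
  rwa [moveCoord, Function.update_self, Function.update_of_ne he.ne, slide_one, sphereInner_self]

theorem continuous_moveCoord {π : Fin n → Fin n} {c : ℝ} (hc : -1 ≤ c) {e : Fin n}
    {A : Set (Fin n → S2)} (hA : A ⊆ nearSet π c {e}) :
    Continuous fun y : unitInterval × A => moveCoord e (π e) y.1 y.2.1 := by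
  have hx : Continuous fun y : unitInterval × A => y.2.1 :=
    continuous_subtype_val.comp continuous_snd
  refine hx.update _ (continuous_slide (continuous_subtype_val.comp continuous_fst)
    ((continuous_apply _).comp hx) ((continuous_apply _).comp hx)
    fun y => slideVec_ne_zero y.1.2.1 y.1.2.2 ?_)
  obtain ⟨t, ht, h⟩ := hA y.2.2
  obtain rfl := Finset.mem_singleton.1 ht
  exact hc.trans_lt h

/-- The homology of a neighbourhood of a forest-like union of diagonals embeds in the homology of
the whole product. -/
theorem homologyCMap_valMap_nearSet_injective (π : Fin n → Fin n) {c : ℝ} (hc : -1 ≤ c)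
    (hc1 : c < 1) (T : Finset (Fin n)) (hT : ∀ t ∈ T, π t < t) (m : ℕ) :
    Function.Injective (homologyCMap m (valMap (nearSet π c T))) := by
  induction T using Finset.induction_on_max generalizing m with
  | empty =>
    have : IsEmpty (nearSet π c ∅) := ⟨fun x => by simpa [nearSet] using x.2⟩
    intro x y _
    rw [homologyC_eq_zero_of_isEmpty m x, homologyC_eq_zero_of_isEmpty m y]
  | insert e T' he ih =>
    have hT' : ∀ t ∈ T', π t < t := fun t ht => hT t (Finset.mem_insert_of_mem ht)
    have hπ : π e < e := hT e (Finset.mem_insert_self _ _)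
    have ih' := fun m => (injective_iff_map_eq_zero _).1 (ih hT' m)
    have hN : nearSet π c (insert e T') = nearSet π c {e} ∪ nearSet π c T' := by
      ext x
      simp [nearSet]
    rw [hN, injective_iff_map_eq_zero]
    set H := nearSet π c {e}
    set N := nearSet π c T'
    have hH : IsOpen H := isOpen_nearSet _ _ _
    have hN' : IsOpen N := isOpen_nearSet _ _ _
    let rN : C(N, ↥(H ∩ N)) := ⟨fun x => ⟨moveCoord e (π e) 1 x,
      moveCoord_one_mem_nearSet_singleton hc1 hπ x, moveCoord_mem_nearSet hT' he 1 x.2⟩,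
      ((continuous_moveCoord_one _ _).comp continuous_subtype_val).subtype_mk _⟩
    let rH : C(Fin n → S2, H) := ⟨fun x => ⟨moveCoord e (π e) 1 x,
      moveCoord_one_mem_nearSet_singleton hc1 hπ x⟩, (continuous_moveCoord_one _ _).subtype_mk _⟩
    -- Sliding x_e to x_{π e} stays in H and in N. Thus `rN` is a homotopy left inverse of H ∩ N →
    -- N, and likewise `rH` of H → (S²)ⁿ.
    have hom1 : ∀ k, homologyCMap k (rN.comp (setIncl Set.inter_subset_right)) =
        homologyCMap k (ContinuousMap.id ↥(H ∩ N)) := fun k =>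
      (homologyCMap_eq_of_homotopy k
        (fun y => ⟨moveCoord e (π e) y.1 y.2.1,
          moveCoord_mem_nearSet_singleton hc hπ y.1.2.1 y.1.2.2 y.2.2.1,
          moveCoord_mem_nearSet hT' he y.1 y.2.2.2⟩)
        ((continuous_moveCoord hc Set.inter_subset_left).subtype_mk _)
        (fun x => Subtype.ext (moveCoord_zero _ _ _)) (fun x => rfl)).symm
    have hom2 : ∀ k, homologyCMap k (rH.comp (valMap H)) =
        homologyCMap k (ContinuousMap.id H) := fun k =>
      (homologyCMap_eq_of_homotopy k
        (fun y => ⟨moveCoord e (π e) y.1 y.2.1,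
          moveCoord_mem_nearSet_singleton hc hπ y.1.2.1 y.1.2.2 y.2.2⟩)
        ((continuous_moveCoord hc subset_rfl).subtype_mk _)
        (fun x => Subtype.ext (moveCoord_zero _ _ _)) (fun x => rfl)).symm
    intro z hz
    obtain ⟨a, b, rfl⟩ : ∃ (a : HomologyC m H) (b : HomologyC m N),
        z = homologyCMap m (setIncl Set.subset_union_left) a +
          homologyCMap m (setIncl Set.subset_union_right) b := by
      cases m with
      | zero => exact exists_add_of_degree_zero hH hN' z
      | succ k =>
        obtain ⟨w, hw⟩ := exists_mvRel hH hN' z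
        -- The boundary dies in N, while H ∩ N → N is injective on homology.
        have hw0 : w = 0 := by
          rw [← homologyCMap_id k w, ← hom1, homologyCMap_comp, hw.map_right_eq_zero, map_zero]
        rw [hw0] at hw
        exact hw.exists_add
    rw [map_add, homologyCMap_valMap_setIncl, homologyCMap_valMap_setIncl] at hz
    -- Apply `rH` to the relation a + b = 0 in (S²)ⁿ: it undoes the inclusion of H, and on N it
    -- factors through `rN`.
    have ha : a = -homologyCMap m (setIncl Set.inter_subset_left) (homologyCMap m rN b) := by
      have h1 := congrArg (homologyCMap m rH) hz
      rw [map_add, map_zero, ← homologyCMap_comp, hom2, homologyCMap_id] at h1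
      rw [eq_neg_iff_add_eq_zero, ← h1]
      congr 1
      exact homologyCMap_eq_of_comp_eq m (f := rN) (g := setIncl Set.inter_subset_left)
        (f' := valMap N) (g' := rH) rfl b
    set d := homologyCMap m rN b
    -- Now b and d agree in (S²)ⁿ, hence in N by induction. So z is -d + d, with d from the
    -- intersection.
    have hb : b = homologyCMap m (setIncl Set.inter_subset_right) d := by
      rw [← sub_eq_zero]
      refine ih' m _ ?_
      rw [map_sub, homologyCMap_valMap_setIncl, sub_eq_neg_add, ← hz, ha, map_neg,
        homologyCMap_valMap_setIncl]
    clear_value d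
    rw [ha, hb, map_neg, homologyCMap_setIncl_setIncl, homologyCMap_setIncl_setIncl, neg_add_cancel]

end Forest

/-! ### Vanishing and dimension at most one -/

/-- The `k`-th homology vanishes. -/
def HomologyVanishes (k : ℕ) (X : Type) [TopologicalSpace X] : Prop :=
  ∀ x : HomologyC k X, x = 0

/-- Any two classes of degree `k` are linearly dependent. -/
def HomologyDependent (k : ℕ) (X : Type) [TopologicalSpace X] : Prop :=
  ∀ x y : HomologyC k X, ∃ c d : ℂ, (c ≠ 0 ∨ d ≠ 0) ∧ c • x + d • y = 0

section Basic

variable {X Y : Type} [TopologicalSpace X] [TopologicalSpace Y] {k : ℕ}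

theorem homologyCMap_injective_of_leftInverse {f : C(X, Y)} {g : C(Y, X)}
    (h : Function.LeftInverse g f) : Function.Injective (homologyCMap k f) := by
  have e : g.comp f = ContinuousMap.id X := ContinuousMap.ext h
  intro a b hab
  rw [← homologyCMap_id k a, ← homologyCMap_id k b, ← e, homologyCMap_comp, hab, homologyCMap_comp]

theorem HomologyVanishes.of_injective {f : C(X, Y)} (hf : Function.Injective (homologyCMap k f))
    (h : HomologyVanishes k Y) : HomologyVanishes k X :=
  fun _ => hf ((h _).trans (map_zero _).symm)

theorem HomologyDependent.of_injective {f : C(X, Y)} (hf : Function.Injective (homologyCMap k f))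
    (h : HomologyDependent k Y) : HomologyDependent k X := by
  intro x y
  obtain ⟨c, d, hcd, e⟩ := h (homologyCMap k f x) (homologyCMap k f y)
  refine ⟨c, d, hcd, hf ?_⟩
  rw [map_add, map_smul, map_smul, e, map_zero]

theorem homologyVanishes_of_unique [Unique X] (hk : k ≠ 0) : HomologyVanishes k X := by
  have h := AlgebraicTopology.isZero_singularHomologyFunctor_of_totallyDisconnectedSpace
    (ModuleCat.{0} ℂ) k (ModuleCat.of ℂ ℂ) (TopCat.of X) hk
  have := ModuleCat.subsingleton_of_isZero h
  exact fun _ => Subsingleton.elim (α := (HomologyC k X : Type)) _ 0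

theorem homologyDependent_zero_of_unique [Unique X] : HomologyDependent 0 X := by
  intro x y
  obtain ⟨z, hz⟩ := exists_representsClass x
  obtain ⟨w, hw⟩ := exists_representsClass y
  let σ : C(stdSimplex ℝ (Fin (0 + 1)), X) := ContinuousMap.const _ default
  have hσ : ∀ τ : C(stdSimplex ℝ (Fin (0 + 1)), X), τ = σ := fun τ =>
    ContinuousMap.ext fun _ => Subsingleton.elim _ _
  obtain ⟨c, d, hcd, e⟩ : ∃ c d : ℂ, (c ≠ 0 ∨ d ≠ 0) ∧ c * z σ + d * w σ = 0 := by
    by_cases h : z σ = 0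
    · exact ⟨1, 0, Or.inl one_ne_zero, by simp [h]⟩
    · exact ⟨-w σ, z σ, Or.inr h, by ring⟩
  refine ⟨c, d, hcd, ((hz.smul c).add (hw.smul d)).unique (h' := 0) ?_⟩
  have h0 : c • z + d • w = 0 := by
    ext τ
    rw [hσ τ]
    simpa using e
  rw [h0]
  simpa using representsClass_boundary (0 : SingChain 1 X)

/-- On a space with at most one class of degree `k` up to scalars, an involution acts by a sign. -/
theorem HomologyDependent.exists_sign (h : HomologyDependent k X) {τ : C(X, X)}
    (hτ : Function.Involutive τ) :
    ∃ ε : ℂ, (ε = 1 ∨ ε = -1) ∧ ∀ x : HomologyC k X, homologyCMap k τ x = ε • x := by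
  have hmul : ∀ x : HomologyC k X, x ≠ 0 → ∀ y : HomologyC k X, ∃ c : ℂ, y = c • x := by
    intro x hx y
    obtain ⟨c, d, hcd, e⟩ := h x y
    have hd : d ≠ 0 := by
      rintro rfl
      rw [zero_smul, add_zero, smul_eq_zero] at e
      rcases hcd with hc | hc
      · exact e.elim hc hx
      · exact hc rfl
    refine ⟨-(d⁻¹ * c), ?_⟩
    rw [neg_smul, mul_smul, eq_neg_iff_add_eq_zero]
    have := congrArg (fun v => d⁻¹ • v) e
    simp only [smul_add, smul_zero] at this
    rw [smul_smul d⁻¹ d, inv_mul_cancel₀ hd, one_smul, add_comm] at this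
    exact this
  by_cases h0 : ∃ x : HomologyC k X, x ≠ 0
  · obtain ⟨x, hx⟩ := h0
    obtain ⟨ε, hε⟩ := hmul x hx (homologyCMap k τ x)
    refine ⟨ε, ?_, fun y => ?_⟩
    · have h2 : homologyCMap k τ (homologyCMap k τ x) = x := by
        rw [← homologyCMap_comp]
        convert homologyCMap_id k x using 2
        congr 1
        exact ContinuousMap.ext hτ
      rw [hε, map_smul, hε, smul_smul] at h2
      have h3 : (ε * ε - 1) • x = 0 := by rw [sub_smul, h2, one_smul, sub_self]
      rcases smul_eq_zero.1 h3 with h4 | h4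
      · exact mul_self_eq_one_iff.1 (sub_eq_zero.1 h4)
      · exact absurd h4 hx
    · obtain ⟨c, rfl⟩ := hmul x hx y
      rw [map_smul, hε, smul_comm]
  · push Not at h0
    exact ⟨1, Or.inl rfl, fun x => by rw [h0 x, map_zero, smul_zero]⟩

end Basic

/-! ### Dimension bounds from Mayer–Vietoris -/

section MayerVietorisConsequences

variable {M : Type} [TopologicalSpace M] {k : ℕ} {A B : Set M}

theorem HomologyVanishes.union (hA : IsOpen A) (hB : IsOpen B) (h : HomologyVanishes k ↥(A ∩ B))
    (hA' : HomologyVanishes (k + 1) A) (hB' : HomologyVanishes (k + 1) B) :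
    HomologyVanishes (k + 1) ↥(A ∪ B) := by
  intro z
  obtain ⟨w, hw⟩ := exists_mvRel hA hB z
  rw [h w] at hw
  obtain ⟨a, b, rfl⟩ := hw.exists_add
  rw [hA' a, hB' b, map_zero, map_zero, add_zero]

theorem HomologyDependent.union (hA : IsOpen A) (hB : IsOpen B)
    (h : HomologyDependent k ↥(A ∩ B)) (hA' : HomologyVanishes (k + 1) A)
    (hB' : HomologyVanishes (k + 1) B) : HomologyDependent (k + 1) ↥(A ∪ B) := by
  intro x y
  obtain ⟨v, hv⟩ := exists_mvRel hA hB x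
  obtain ⟨w, hw⟩ := exists_mvRel hA hB y
  obtain ⟨c, d, hcd, e⟩ := h v w
  have hz := (hv.smul c).add (hw.smul d)
  rw [e] at hz
  obtain ⟨a, b, hab⟩ := hz.exists_add
  refine ⟨c, d, hcd, ?_⟩
  rw [hab, hA' a, hB' b, map_zero, map_zero, add_zero]

theorem exists_add_of_disjoint (hA : IsOpen A) (hB : IsOpen B) (hAB : Disjoint A B)
    (z : HomologyC k ↥(A ∪ B)) : ∃ (a : HomologyC k A) (b : HomologyC k B),
      z = homologyCMap k (setIncl Set.subset_union_left) a +
        homologyCMap k (setIncl Set.subset_union_right) b := by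
  cases k with
  | zero => exact exists_add_of_degree_zero hA hB z
  | succ k =>
    obtain ⟨w, hw⟩ := exists_mvRel hA hB z
    have : IsEmpty ↥(A ∩ B) := ⟨fun x => Set.disjoint_left.1 hAB x.2.1 x.2.2⟩
    rw [homologyC_eq_zero_of_isEmpty k w] at hw
    exact hw.exists_add

theorem exists_add_of_eq_disjoint_union {P N D : Set M} (hP : IsOpen P) (hN : IsOpen N)
    (hPN : Disjoint P N) (hD : D = P ∪ N) (z : HomologyC k D) :
    ∃ (a : HomologyC k P) (b : HomologyC k N),
      z = homologyCMap k (setIncl (Set.subset_union_left.trans hD.ge)) a +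
        homologyCMap k (setIncl (Set.subset_union_right.trans hD.ge)) b := by
  subst hD
  exact exists_add_of_disjoint hP hN hPN z

theorem HomologyVanishes.of_eq_disjoint_union {P N D : Set M} (hP : IsOpen P) (hN : IsOpen N)
    (hPN : Disjoint P N) (hD : D = P ∪ N) (h : HomologyVanishes k P) (h' : HomologyVanishes k N) :
    HomologyVanishes k D := by
  intro z
  obtain ⟨a, b, rfl⟩ := exists_add_of_eq_disjoint_union hP hN hPN hD z
  rw [h a, h' b, map_zero, map_zero, add_zero]

/-- The boundaries live on two disjoint pieces. A linear relation between the P-components leaves a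
class from N; it dies in B, so it vanishes because N → B is injective on homology. Thus only P
limits the dimension. -/
theorem HomologyDependent.union_of_inter_eq {P N : Set M} (hA : IsOpen A) (hB : IsOpen B)
    (hP : IsOpen P) (hN : IsOpen N) (hPN : Disjoint P N) (hD : A ∩ B = P ∪ N)
    (h : HomologyDependent k P) (hNB : N ⊆ B)
    (hinj : Function.Injective (homologyCMap k (setIncl hNB)))
    (hA' : HomologyVanishes (k + 1) A) (hB' : HomologyVanishes (k + 1) B) :
    HomologyDependent (k + 1) ↥(A ∪ B) := by
  intro x y
  obtain ⟨v, hv⟩ := exists_mvRel hA hB x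
  obtain ⟨w, hw⟩ := exists_mvRel hA hB y
  obtain ⟨a, b, hab⟩ := exists_add_of_eq_disjoint_union hP hN hPN hD v
  obtain ⟨a', b', hab'⟩ := exists_add_of_eq_disjoint_union hP hN hPN hD w
  obtain ⟨c, d, hcd, e⟩ := h a a'
  have hz := (hv.smul c).add (hw.smul d)
  have hvw : c • v + d • w = homologyCMap k (setIncl (Set.subset_union_right.trans hD.ge))
      (c • b + d • b') := by
    have e' := congrArg (homologyCMap k (setIncl (Set.subset_union_left.trans hD.ge))) e
    rw [map_zero, map_add, map_smul, map_smul] at e'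
    rw [hab, hab', map_add, map_smul, map_smul, smul_add, smul_add, add_add_add_comm, e', zero_add]
  have hb : c • b + d • b' = 0 := by
    apply hinj
    have h2 := hz.map_right_eq_zero
    rw [map_zero]
    rwa [hvw, homologyCMap_setIncl_setIncl] at h2
  rw [hvw, hb, map_zero] at hz
  obtain ⟨a₁, b₁, hab₁⟩ := hz.exists_add
  refine ⟨c, d, hcd, ?_⟩
  rw [hab₁, hA' a₁, hB' b₁, map_zero, map_zero, add_zero]

end MayerVietorisConsequences

/-! ### The top homology of a product with S² -/

section StarShaped

/-- The set `A` contains the geodesics from its points to `q`. -/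
def SphereStarShaped (A : Set S2) (q : S2) : Prop :=
  ∀ p ∈ A, -1 < sphereInner p q ∧ ∀ s : unitInterval, slide s p q ∈ A

/-- The open cap around `q` bounded by the height `c`. -/
def sphereCap (c : ℝ) (q : S2) : Set S2 := {p | c < sphereInner p q}

theorem sphereStarShaped_cap {c : ℝ} (hc : -1 ≤ c) (q : S2) :
    SphereStarShaped (sphereCap c q) q := fun p (hp : c < sphereInner p q) =>
  ⟨hc.trans_lt hp, fun s => hp.trans_le (le_sphereInner_slide s.2.1 s.2.2 (hc.trans_lt hp))⟩

variable {Y : Type} [TopologicalSpace Y] {k : ℕ}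

/-- The cylinder over a subset of the sphere. -/
abbrev cyl (Y : Type) (A : Set S2) : Set (S2 × Y) := Prod.fst ⁻¹' A

/-- The projection of a cylinder to its base. -/
def cylProj (A : Set S2) : C((cyl Y A), Y) :=
  ⟨fun x => x.1.2, continuous_snd.comp continuous_subtype_val⟩

theorem SphereStarShaped.homologyCMap_cylProj_injective {A : Set S2} {q : S2}
    (h : SphereStarShaped A q) :
    Function.Injective (homologyCMap k (cylProj (Y := Y) A)) := by
  rcases A.eq_empty_or_nonempty with rfl | ⟨p₀, hp₀⟩
  · have : IsEmpty (cyl Y ∅) := ⟨fun x => x.2⟩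
    intro x y _
    rw [homologyC_eq_zero_of_isEmpty k x, homologyC_eq_zero_of_isEmpty k y]
  have hq : q ∈ A := by simpa using (h p₀ hp₀).2 1
  let j : C(Y, (cyl Y A)) :=
    ⟨fun y => ⟨(q, y), hq⟩, (Continuous.prodMk_right q).subtype_mk _⟩
  have e : homologyCMap k (ContinuousMap.id (cyl Y A)) =
      homologyCMap k (j.comp (cylProj A)) :=
    homologyCMap_eq_of_homotopy k
      (fun y => ⟨(slide y.1 y.2.1.1 q, y.2.1.2), (h _ y.2.2).2 y.1⟩)
      (Continuous.subtype_mk (Continuous.prodMk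
        (continuous_slide (continuous_subtype_val.comp continuous_fst)
          (continuous_fst.comp (continuous_subtype_val.comp continuous_snd)) continuous_const
          fun y => slideVec_ne_zero y.1.2.1 y.1.2.2 (h _ y.2.2).1)
        (continuous_snd.comp (continuous_subtype_val.comp continuous_snd))) _)
      (fun x => Subtype.ext (Prod.ext (slide_zero _ _) rfl))
      (fun x => Subtype.ext (Prod.ext (slide_one _ _) rfl))
  intro a b hab
  rw [← homologyCMap_id k a, ← homologyCMap_id k b, e, homologyCMap_comp, hab, homologyCMap_comp]

theorem SphereStarShaped.vanishes {A : Set S2} {q : S2} (h : SphereStarShaped A q)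
    (hY : HomologyVanishes k Y) : HomologyVanishes k (cyl Y A) :=
  hY.of_injective h.homologyCMap_cylProj_injective

/-- The `i`-th standard basis vector, as a point of the sphere. -/
def basisPoint (i : Fin 3) : S2 :=
  ⟨EuclideanSpace.single i 1, by simp⟩

theorem sphereInner_basisPoint (p : S2) (i : Fin 3) : sphereInner p (basisPoint i) = p.1 i := by
  simp [sphereInner, basisPoint, EuclideanSpace.inner_single_right]

theorem sphere_coord_sq (p : S2) : p.1 0 ^ 2 + p.1 1 ^ 2 + p.1 2 ^ 2 = 1 := by
  have hp : ‖(p : EuclideanSpace ℝ (Fin 3))‖ = 1 := mem_sphere_zero_iff_norm.1 p.2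
  have := EuclideanSpace.real_norm_sq_eq (p : EuclideanSpace ℝ (Fin 3))
  rw [hp, Fin.sum_univ_three] at this
  linarith

/-- The part of the sphere off half of a great circle. -/
def slitSphere (ε : ℝ) : Set S2 := {p | p.1 1 ≠ 0 ∨ 0 < ε * p.1 0}

theorem isOpen_slitSphere (ε : ℝ) : IsOpen (slitSphere ε) := by
  have h : ∀ i, Continuous fun p : S2 => p.1 i := fun i => by fun_prop
  exact (isOpen_ne_fun (h 1) continuous_const).union
    (isOpen_lt continuous_const ((h 0).const_smul ε))

/-- Here ε = ±1 and the removed half circle passes through -q. Sliding towards `q` multiplies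
coordinate 1 by a positive factor until s = 1, and keeps a positive component along `q` positive. -/
theorem sphereStarShaped_slitSphere_aux {ε : ℝ} (hε : ε ^ 2 = 1) {q : S2}
    (hq : ∀ p : S2, sphereInner p q = ε * p.1 0) (hq0 : q.1 0 = ε) (hq1 : q.1 1 = 0) :
    SphereStarShaped (slitSphere ε) q := by
  intro p hp
  have hlt : -1 < sphereInner p q := by
    have h := sphere_coord_sq p
    rw [hq]
    rcases hp with hp | hp
    · have h1 : 0 < p.1 1 ^ 2 := by positivity
      nlinarith [sq_nonneg (p.1 2)]
    · linarith
  refine ⟨hlt, fun s => ?_⟩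
  have hv := slideVec_ne_zero s.2.1 s.2.2 hlt
  have hpos : 0 < ‖slideVec s p q‖⁻¹ := inv_pos.2 (norm_pos_iff.2 hv)
  have h0 : (slideVec s p q) 0 = (1 - s) * p.1 0 + s * ε := by simp [slideVec, hq0]
  have h1 : (slideVec s p q) 1 = (1 - s) * p.1 1 := by simp [slideVec, hq1]
  change (slide s p q).1 1 ≠ 0 ∨ 0 < ε * (slide s p q).1 0
  rw [slide_coe hv, PiLp.smul_apply, PiLp.smul_apply, h0, h1, smul_eq_mul, smul_eq_mul]
  have hs0 : 0 ≤ (s : ℝ) := s.2.1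
  rcases s.2.2.eq_or_lt with hs | hs
  · right
    rw [hs] at hpos ⊢
    calc 0 < ‖slideVec 1 p q‖⁻¹ * ε ^ 2 := by rw [hε, mul_one]; exact hpos
      _ = _ := by ring
  rcases hp with hp | hp
  · left
    have : 1 - (s : ℝ) ≠ 0 := by linarith
    positivity
  · right
    have : 0 < (1 - s) * (ε * p.1 0) + s * ε ^ 2 := by
      rw [hε]
      nlinarith [mul_pos (sub_pos.2 hs) hp]
    calc 0 < ‖slideVec s p q‖⁻¹ * ((1 - s) * (ε * p.1 0) + s * ε ^ 2) := mul_pos hpos this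
      _ = _ := by ring

theorem sphereStarShaped_slitSphere_one : SphereStarShaped (slitSphere 1) (basisPoint 0) :=
  sphereStarShaped_slitSphere_aux (by norm_num)
    (fun p => by rw [sphereInner_basisPoint, one_mul]) (by simp [basisPoint]) (by simp [basisPoint])

theorem sphereStarShaped_slitSphere_neg_one :
    SphereStarShaped (slitSphere (-1)) (-basisPoint 0) :=
  sphereStarShaped_slitSphere_aux (by norm_num)
    (fun p => by rw [sphereInner_neg_right, sphereInner_basisPoint, neg_one_mul])
    (by simp [basisPoint]) (by simp [basisPoint])

theorem isOpen_sphereCap (c : ℝ) (q : S2) : IsOpen (sphereCap c q) :=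
  isOpen_lt continuous_const (by fun_prop)

theorem sphereCap_union_neg (q : S2) : sphereCap (-1) (-q) ∪ sphereCap (-1) q = Set.univ := by
  ext p
  simp only [sphereCap, sphereInner_neg_right, Set.mem_union, Set.mem_ofPred_eq, Set.mem_univ,
    iff_true]
  by_contra! h
  linarith [h.1, h.2]

theorem sphereCap_inter_neg :
    sphereCap (-1) (-basisPoint 2) ∩ sphereCap (-1) (basisPoint 2) =
      slitSphere 1 ∪ slitSphere (-1) := by
  ext p
  have h := sphere_coord_sq p
  simp only [sphereCap, slitSphere, sphereInner_neg_right, sphereInner_basisPoint, Set.mem_inter_iff,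
    Set.mem_union, Set.mem_ofPred_eq]
  constructor
  · rintro ⟨h1, h2⟩
    by_contra! h3
    obtain ⟨⟨h4, h5⟩, -, h6⟩ := h3
    have h7 : p.1 0 = 0 := by linarith
    rw [h4, h7] at h
    nlinarith
  · intro h1
    have h2 : 0 < p.1 0 ^ 2 + p.1 1 ^ 2 := by
      rcases h1 with (h1 | h1) | (h1 | h1)
      · positivity
      · have : p.1 0 ≠ 0 := by rintro h3; rw [h3] at h1; simp at h1
        positivity
      · positivity
      · have : p.1 0 ≠ 0 := by rintro h3; rw [h3] at h1; simp at h1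
        positivity
    constructor <;> nlinarith

theorem slitSphere_inter :
    slitSphere 1 ∩ slitSphere (-1) = sphereCap 0 (basisPoint 1) ∪ sphereCap 0 (-basisPoint 1) := by
  ext p
  simp only [sphereCap, slitSphere, sphereInner_neg_right, sphereInner_basisPoint, Set.mem_inter_iff,
    Set.mem_union, Set.mem_ofPred_eq]
  constructor
  · rintro ⟨h1 | h1, h2 | h2⟩
    · exact h1.lt_or_gt.symm.imp_right fun h => neg_pos.2 h
    · exact h1.lt_or_gt.symm.imp_right fun h => neg_pos.2 h
    · exact h2.lt_or_gt.symm.imp_right fun h => neg_pos.2 h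
    · linarith
  · rintro (h1 | h1)
    · exact ⟨Or.inl h1.ne', Or.inl h1.ne'⟩
    · have : p.1 1 ≠ 0 := by linarith
      exact ⟨Or.inl this, Or.inl this⟩

theorem disjoint_caps : Disjoint (sphereCap 0 (basisPoint 1)) (sphereCap 0 (-basisPoint 1)) := by
  rw [Set.disjoint_left]
  intro p h1 h2
  simp only [sphereCap, sphereInner_neg_right, Set.mem_ofPred_eq] at h1 h2
  linarith

theorem isOpen_cyl {A : Set S2} (hA : IsOpen A) : IsOpen (cyl Y A) := hA.preimage continuous_fst

theorem cyl_slitSphere_inter (Y : Type) : cyl Y (slitSphere 1) ∩ cyl Y (slitSphere (-1)) =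
    cyl Y (sphereCap 0 (basisPoint 1)) ∪ cyl Y (sphereCap 0 (-basisPoint 1)) :=
  congrArg (cyl Y) slitSphere_inter

theorem cyl_slitSphere_union (Y : Type) : cyl Y (slitSphere 1) ∪ cyl Y (slitSphere (-1)) =
    cyl Y (sphereCap (-1) (-basisPoint 2)) ∩ cyl Y (sphereCap (-1) (basisPoint 2)) :=
  congrArg (cyl Y) sphereCap_inter_neg.symm

theorem vanishes_slit (h0 : HomologyVanishes k Y) (h1 : HomologyVanishes (k + 1) Y) :
    HomologyVanishes (k + 1) ↥(cyl Y (slitSphere 1) ∪ cyl Y (slitSphere (-1))) :=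
  HomologyVanishes.union (isOpen_cyl (isOpen_slitSphere _)) (isOpen_cyl (isOpen_slitSphere _))
    (HomologyVanishes.of_eq_disjoint_union (isOpen_cyl (isOpen_sphereCap _ _))
      (isOpen_cyl (isOpen_sphereCap _ _)) (disjoint_caps.preimage _) (cyl_slitSphere_inter Y)
      ((sphereStarShaped_cap (by norm_num) _).vanishes h0)
      ((sphereStarShaped_cap (by norm_num) _).vanishes h0))
    (sphereStarShaped_slitSphere_one.vanishes h1) (sphereStarShaped_slitSphere_neg_one.vanishes h1)

/-- The sphere without its poles is covered by two slit spheres that meet in two hemispheres, like a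
circle covered by two arcs. A hemisphere and a slit sphere, times Y, both project to Y injectively
on homology, which gives injectivity of the inclusion of the second hemisphere. -/
theorem dependent_slit (h0 : HomologyDependent k Y) (h1 : HomologyVanishes (k + 1) Y) :
    HomologyDependent (k + 1) ↥(cyl Y (slitSphere 1) ∪ cyl Y (slitSphere (-1))) := by
  have hsub : cyl Y (sphereCap 0 (-basisPoint 1)) ⊆ cyl Y (slitSphere (-1)) :=
    Set.subset_union_right.trans ((cyl_slitSphere_inter Y).ge.trans Set.inter_subset_right)
  refine HomologyDependent.union_of_inter_eq (isOpen_cyl (isOpen_slitSphere _))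
    (isOpen_cyl (isOpen_slitSphere _)) (isOpen_cyl (isOpen_sphereCap _ _))
    (isOpen_cyl (isOpen_sphereCap _ _)) (disjoint_caps.preimage _) (cyl_slitSphere_inter Y)
    (h0.of_injective (sphereStarShaped_cap (by norm_num) _).homologyCMap_cylProj_injective) hsub
    ?_ (sphereStarShaped_slitSphere_one.vanishes h1)
    (sphereStarShaped_slitSphere_neg_one.vanishes h1)
  intro a b hab
  apply (sphereStarShaped_cap (c := 0) (by norm_num)
    (-basisPoint 1)).homologyCMap_cylProj_injective (Y := Y)
  have h3 := congrArg (homologyCMap k (cylProj (Y := Y) (slitSphere (-1)))) hab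
  rw [← homologyCMap_comp, ← homologyCMap_comp] at h3
  exact h3

theorem homologyCMap_toUniv_injective {X : Type} [TopologicalSpace X] {A : Set X}
    (hA : A = Set.univ) : Function.Injective (homologyCMap k
      (⟨fun x => ⟨x, hA ▸ trivial⟩, continuous_id.subtype_mk _⟩ : C(X, A))) :=
  homologyCMap_injective_of_leftInverse (g := valMap A) fun _ => rfl

theorem HomologyVanishes.sphere_prod (h0 : HomologyVanishes k Y) (h1 : HomologyVanishes (k + 1) Y)
    (h2 : HomologyVanishes (k + 2) Y) : HomologyVanishes (k + 2) (S2 × Y) := by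
  refine HomologyVanishes.of_injective (homologyCMap_toUniv_injective
    (A := cyl Y (sphereCap (-1) (-basisPoint 2)) ∪ cyl Y (sphereCap (-1) (basisPoint 2)))
    (congrArg (cyl Y) (sphereCap_union_neg (basisPoint 2)))) ?_
  refine HomologyVanishes.union (isOpen_cyl (isOpen_sphereCap _ _))
    (isOpen_cyl (isOpen_sphereCap _ _)) ?_ ((sphereStarShaped_cap le_rfl _).vanishes h2)
    ((sphereStarShaped_cap le_rfl _).vanishes h2)
  have h := vanishes_slit h0 h1
  rwa [cyl_slitSphere_union] at h

/-- Two Mayer–Vietoris steps, each lowering the degree by one: from S² to the sphere without two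
poles, then to two hemispheres. -/
theorem HomologyDependent.sphere_prod (h0 : HomologyDependent k Y)
    (h1 : HomologyVanishes (k + 1) Y) (h2 : HomologyVanishes (k + 2) Y) :
    HomologyDependent (k + 2) (S2 × Y) := by
  refine HomologyDependent.of_injective (homologyCMap_toUniv_injective
    (A := cyl Y (sphereCap (-1) (-basisPoint 2)) ∪ cyl Y (sphereCap (-1) (basisPoint 2)))
    (congrArg (cyl Y) (sphereCap_union_neg (basisPoint 2)))) ?_
  refine HomologyDependent.union (isOpen_cyl (isOpen_sphereCap _ _))
    (isOpen_cyl (isOpen_sphereCap _ _)) ?_ ((sphereStarShaped_cap le_rfl _).vanishes h2)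
    ((sphereStarShaped_cap le_rfl _).vanishes h2)
  have h := dependent_slit h0 h1
  rwa [cyl_slitSphere_union] at h

end StarShaped

/-! ### Homology of powers of S² -/

theorem homologyCMap_piSucc_injective (k m : ℕ) : Function.Injective (homologyCMap m
    (⟨fun x => (x 0, fun i => x i.succ), by fun_prop⟩ : C(Fin (k + 1) → S2, S2 × (Fin k → S2)))) :=
  homologyCMap_injective_of_leftInverse
    (g := ⟨fun y => Fin.cons (α := fun _ => S2) y.1 y.2,
      Continuous.finCons (A := fun _ => S2) continuous_fst continuous_snd⟩)
    fun _ => funext fun i => Fin.cases rfl (fun _ => rfl) i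

theorem homologyVanishes_sphere_pow (k : ℕ) : ∀ m, 2 * k < m → HomologyVanishes m (Fin k → S2) := by
  induction k with
  | zero => exact fun m hm => homologyVanishes_of_unique (by omega)
  | succ k ih =>
    intro m hm
    obtain ⟨m, rfl⟩ : ∃ l, m = l + 2 := ⟨m - 2, by omega⟩
    exact HomologyVanishes.of_injective (homologyCMap_piSucc_injective k _)
      (HomologyVanishes.sphere_prod (ih _ (by omega)) (ih _ (by omega)) (ih _ (by omega)))

theorem homologyDependent_sphere_pow (k : ℕ) : HomologyDependent (2 * k) (Fin k → S2) := by
  induction k with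
  | zero => exact homologyDependent_zero_of_unique
  | succ k ih =>
    exact HomologyDependent.of_injective (homologyCMap_piSucc_injective k _)
      (HomologyDependent.sphere_prod (k := 2 * k) ih
        (homologyVanishes_sphere_pow k _ (by omega)) (homologyVanishes_sphere_pow k _ (by omega)))

/-! ### Combinatorics of noncrossing matchings -/

namespace NoncrossingMatching

variable {n : ℕ} (a b : NoncrossingMatching n)

/-- The vertex `i` is the left endpoint of an arc. -/
def IsLeft (i : Fin n) : Prop := ∃ j, (i, j) ∈ a.arcs

variable {a b}

theorem eq_of_endpoint {e e' : Fin n × Fin n} (he : e ∈ a.arcs) (he' : e' ∈ a.arcs) {i : Fin n}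
    (hi : e.1 = i ∨ e.2 = i) (hi' : e'.1 = i ∨ e'.2 = i) : e = e' :=
  (a.perfect i).unique ⟨he, hi⟩ ⟨he', hi'⟩

theorem exists_left_of_not_isLeft {i : Fin n} (h : ¬ a.IsLeft i) : ∃ j, (j, i) ∈ a.arcs := by
  obtain ⟨⟨j, k⟩, ⟨he, h1 | h1⟩, -⟩ := a.perfect i
  · subst h1
    exact absurd ⟨k, he⟩ h
  · subst h1
    exact ⟨j, he⟩

theorem not_isLeft_of_mem {i j : Fin n} (h : (i, j) ∈ a.arcs) : ¬ a.IsLeft j := by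
  rintro ⟨k, hk⟩
  have := eq_of_endpoint h hk (Or.inr rfl) (Or.inl rfl)
  have h1 := a.left_lt_right _ h
  simp_all

theorem left_eq {i i' j : Fin n} (h : (i, j) ∈ a.arcs) (h' : (i', j) ∈ a.arcs) : i = i' :=
  congrArg Prod.fst (eq_of_endpoint h h' (Or.inr rfl) (Or.inr rfl))

theorem right_eq {i j j' : Fin n} (h : (i, j) ∈ a.arcs) (h' : (i, j') ∈ a.arcs) : j = j' :=
  congrArg Prod.snd (eq_of_endpoint h h' (Or.inl rfl) (Or.inl rfl))

/-- Consider the partner w of v' in `a`. If w < u, then `b` would match v' to w as well as to u; w =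
u gives v' = v; and w > u makes (v', w) cross (v, u). -/
theorem arc_agree_aux {u v v' : Fin n}
    (ih : ∀ w < u, ∀ v, (v, w) ∈ a.arcs → (v, w) ∈ b.arcs)
    (h : ∀ s ≤ u, (a.IsLeft s ↔ b.IsLeft s)) (ha : (v, u) ∈ a.arcs) (hb : (v', u) ∈ b.arcs) :
    ¬ v < v' := by
  intro hvv
  have hv'u : v' < u := b.left_lt_right _ hb
  obtain ⟨w, hw⟩ := (h v' hv'u.le).2 ⟨u, hb⟩
  rcases lt_trichotomy w u with hwu | rfl | hwu
  · exact hwu.ne (right_eq (ih w hwu v' hw) hb)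
  · exact hvv.ne (left_eq ha hw)
  · exact a.noncrossing _ ha _ hw ⟨hvv, hv'u, hwu⟩

/-- Two matchings with the same left endpoints up to `u` have the same arc ending at `u`. -/
theorem arc_agree (u : Fin n) (h : ∀ s ≤ u, (a.IsLeft s ↔ b.IsLeft s)) (v : Fin n) :
    (v, u) ∈ a.arcs ↔ (v, u) ∈ b.arcs := by
  induction u using WellFoundedLT.induction generalizing v with
  | ind u ih =>
    have ih' : ∀ w < u, ∀ v, (v, w) ∈ a.arcs ↔ (v, w) ∈ b.arcs := fun w hw v =>
      ih w hw (fun s hs => h s (hs.trans hw.le)) v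
    by_cases hu : a.IsLeft u
    · have hu' := (h u le_rfl).1 hu
      exact ⟨fun hv => absurd hu (not_isLeft_of_mem hv), fun hv => absurd hu' (not_isLeft_of_mem hv)⟩
    · obtain ⟨s, hs⟩ := exists_left_of_not_isLeft hu
      obtain ⟨s', hs'⟩ := exists_left_of_not_isLeft (mt (h u le_rfl).2 hu)
      have h1 := arc_agree_aux (fun w hw v => (ih' w hw v).1) h hs hs'
      have h2 := arc_agree_aux (fun w hw v => (ih' w hw v).2) (fun s hs => (h s hs).symm) hs' hs
      obtain rfl : s = s' := le_antisymm (not_lt.1 h2) (not_lt.1 h1)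
      exact ⟨fun hv => left_eq hs hv ▸ hs', fun hv => left_eq hs' hv ▸ hs⟩

variable (a) in
open Classical in
/-- The word recording which vertices are left endpoints. -/
def word : Lex (Fin n → Bool) := toLex fun i => decide (a.IsLeft i)

theorem word_injective : Function.Injective (word : NoncrossingMatching n → _) := by
  classical
  intro a b h
  have h' : ∀ s, a.IsLeft s ↔ b.IsLeft s := fun s => by
    have := congrFun (toLex.injective h) s
    simpa using this
  have harcs : a.arcs = b.arcs := Finset.ext fun e => arc_agree e.2 (fun s _ => h' s) e.1
  cases a
  cases b
  congr

instance : LinearOrder (NoncrossingMatching n) := LinearOrder.lift' word word_injective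

instance : Finite (NoncrossingMatching n) :=
  Finite.of_injective (fun a : NoncrossingMatching n => a.word) word_injective

theorem lt_iff : a < b ↔
    ∃ t, (∀ s < t, (a.IsLeft s ↔ b.IsLeft s)) ∧ ¬ a.IsLeft t ∧ b.IsLeft t := by
  classical
  change (∃ t, (∀ s < t, decide (a.IsLeft s) = decide (b.IsLeft s)) ∧
    decide (a.IsLeft t) < decide (b.IsLeft t)) ↔ _
  simp only [decide_eq_decide, Bool.lt_iff, decide_eq_false_iff_not, decide_eq_true_eq]

variable (a) in
/-- The arc starting at `i` is the innermost arc around the arc starting at `t`. -/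
def IsParent (i t : Fin n) : Prop :=
  a.IsLeft t ∧ i < t ∧ (∃ j, (i, j) ∈ a.arcs ∧ t < j) ∧
    ∀ k l, (k, l) ∈ a.arcs → k < t → t < l → k ≤ i

theorem IsParent.unique {i i' t : Fin n} (h : a.IsParent i t) (h' : a.IsParent i' t) : i = i' := by
  obtain ⟨-, h1, ⟨j, h2, h3⟩, h4⟩ := h
  obtain ⟨-, h1', ⟨j', h2', h3'⟩, h4'⟩ := h'
  exact le_antisymm (h4' _ _ h2 h1 h3) (h4 _ _ h2' h1' h3')

/-- If `x` lies in the component of `a < b`, it takes the same value at the left endpoints of two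
nested arcs of `b`. -/
theorem exists_parent_eq {x : Fin n → S2} (hab : a < b) (ha : x ∈ component a) :
    ∃ i t, b.IsParent i t ∧ x t = x i := by
  -- At the first difference t of the words, `a` closes an arc (i, t) and `b` opens one. All arcs
  -- ending before t agree, so in `b` the arc from i is still open at t. An arc of `b` opened
  -- strictly between and still open at t would give an arc of `a` crossing (i, t).
  obtain ⟨t, hlt, hat, hbt⟩ := lt_iff.1 hab
  obtain ⟨i, hi⟩ := exists_left_of_not_isLeft hat
  have hit : i < t := a.left_lt_right _ hi
  have key : ∀ w < t, ∀ v, (v, w) ∈ a.arcs ↔ (v, w) ∈ b.arcs := fun w hw =>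
    arc_agree w fun s hs => hlt s (hs.trans_lt hw)
  have hbi : b.IsLeft i := (hlt i hit).1 ⟨t, hi⟩
  obtain ⟨j, hj⟩ := hbi
  refine ⟨i, t, ⟨hbt, hit, ⟨j, hj, ?_⟩, fun k l hkl hkt htl => ?_⟩, (ha _ hi).symm⟩
  · rcases lt_trichotomy t j with h | rfl | h
    · exact h
    · exact absurd hbt (not_isLeft_of_mem hj)
    · exact absurd (right_eq ((key j h i).2 hj) hi) h.ne
  · by_contra! hik
    obtain ⟨w, hw⟩ := (hlt k hkt).2 ⟨l, hkl⟩
    rcases lt_trichotomy w t with h | rfl | h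
    · exact (h.trans htl).ne (right_eq ((key w h k).1 hw) hkl)
    · exact hik.ne (left_eq hi hw)
    · exact a.noncrossing _ hi _ hw ⟨hik, hkt, h⟩

open Classical in
/-- Replaces two nested arcs by two unnested ones. -/
theorem exists_lt_of_isParent {i t : Fin n} (h : b.IsParent i t) {x : Fin n → S2}
    (hx : x ∈ component b) (hxt : x t = x i) : ∃ a, a < b ∧ x ∈ component a := by
  obtain ⟨⟨t', ht'⟩, hit, ⟨j, hij, htj⟩, hmax⟩ := h
  have htt' : t < t' := b.left_lt_right _ ht'
  have ht'j : t' < j := by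
    rcases lt_trichotomy t' j with h | rfl | h
    · exact h
    · exact absurd (left_eq hij ht') hit.ne
    · exact absurd ⟨hit, htj, h⟩ (b.noncrossing _ hij _ ht')
  set A : Finset (Fin n × Fin n) :=
    insert (i, t) (insert (t', j) ((b.arcs.erase (i, j)).erase (t, t'))) with hA
  have memA : ∀ e, e ∈ A ↔ e = (i, t) ∨ e = (t', j) ∨ (e ∈ b.arcs ∧ e ≠ (i, j) ∧ e ≠ (t, t')) := by
    intro e
    simp only [hA, Finset.mem_insert, Finset.mem_erase]
    tauto
  have old : ∀ k l, (k, l) ∈ b.arcs → (k, l) ≠ (i, j) → (k, l) ≠ (t, t') →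
      k ≠ i ∧ k ≠ j ∧ k ≠ t ∧ k ≠ t' ∧ l ≠ i ∧ l ≠ j ∧ l ≠ t ∧ l ≠ t' := by
    intro k l hkl h1 h2
    have e1 : ∀ v, (k = v ∨ l = v) → (i = v ∨ j = v) → False := fun v hv hv' =>
      h1 (eq_of_endpoint hkl hij hv hv')
    have e2 : ∀ v, (k = v ∨ l = v) → (t = v ∨ t' = v) → False := fun v hv hv' =>
      h2 (eq_of_endpoint hkl ht' hv hv')
    refine ⟨fun h => e1 i (Or.inl h) (Or.inl rfl), fun h => e1 j (Or.inl h) (Or.inr rfl),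
      fun h => e2 t (Or.inl h) (Or.inl rfl), fun h => e2 t' (Or.inl h) (Or.inr rfl),
      fun h => e1 i (Or.inr h) (Or.inl rfl), fun h => e1 j (Or.inr h) (Or.inr rfl),
      fun h => e2 t (Or.inr h) (Or.inl rfl), fun h => e2 t' (Or.inr h) (Or.inr rfl)⟩
  let a : NoncrossingMatching n :=
    { arcs := A
      left_lt_right := by
        intro e he
        rcases (memA e).1 he with rfl | rfl | ⟨h, -⟩
        · exact hit
        · exact ht'j
        · exact b.left_lt_right e h
      perfect := by
        intro v
        obtain ⟨⟨k, l⟩, ⟨he, hv⟩, huniq⟩ := b.perfect v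
        have hu : ∀ e ∈ b.arcs, e.1 = v ∨ e.2 = v → e = (k, l) := fun e h h' => huniq e ⟨h, h'⟩
        by_cases h1 : (k, l) = (i, j)
        · obtain ⟨rfl, rfl⟩ := Prod.mk.inj h1
          have hne : ¬ (t = v ∨ t' = v) := fun h => by
            have := congrArg Prod.fst (hu _ ht' h)
            exact hit.ne' this
          push Not at hne
          have hrest : ∀ e, e ∈ b.arcs ∧ e ≠ (k, l) ∧ e ≠ (t, t') → ¬ (e.1 = v ∨ e.2 = v) :=
            fun e h h' => h.2.1 (hu e h.1 h')
          rcases hv with rfl | rfl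
          · refine ⟨(k, t), ⟨(memA _).2 (Or.inl rfl), Or.inl rfl⟩, ?_⟩
            rintro e ⟨h, h'⟩
            rcases (memA e).1 h with rfl | rfl | h
            · rfl
            · rcases h' with h' | h'
              · exact absurd h' hne.2
              · exact absurd h' (hit.trans htj).ne'
            · exact absurd h' (hrest e h)
          · refine ⟨(t', l), ⟨(memA _).2 (Or.inr (Or.inl rfl)), Or.inr rfl⟩, ?_⟩
            rintro e ⟨h, h'⟩
            rcases (memA e).1 h with rfl | rfl | h
            · rcases h' with h' | h'
              · exact absurd h' (hit.trans htj).ne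
              · exact absurd h' hne.1
            · rfl
            · exact absurd h' (hrest e h)
        · by_cases h2 : (k, l) = (t, t')
          · obtain ⟨rfl, rfl⟩ := Prod.mk.inj h2
            have hne : ¬ (i = v ∨ j = v) := fun h => by
              have := congrArg Prod.fst (hu _ hij h)
              exact hit.ne this
            push Not at hne
            have hrest : ∀ e, e ∈ b.arcs ∧ e ≠ (i, j) ∧ e ≠ (k, l) → ¬ (e.1 = v ∨ e.2 = v) :=
              fun e h h' => h.2.2 (hu e h.1 h')
            rcases hv with rfl | rfl
            · refine ⟨(i, k), ⟨(memA _).2 (Or.inl rfl), Or.inr rfl⟩, ?_⟩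
              rintro e ⟨h, h'⟩
              rcases (memA e).1 h with rfl | rfl | h
              · rfl
              · rcases h' with h' | h'
                · exact absurd h' htt'.ne'
                · exact absurd h' hne.2
              · exact absurd h' (hrest e h)
            · refine ⟨(l, j), ⟨(memA _).2 (Or.inr (Or.inl rfl)), Or.inl rfl⟩, ?_⟩
              rintro e ⟨h, h'⟩
              rcases (memA e).1 h with rfl | rfl | h
              · rcases h' with h' | h'
                · exact absurd h' hne.1
                · exact absurd h' htt'.ne
              · rfl
              · exact absurd h' (hrest e h)
          · refine ⟨(k, l), ⟨(memA _).2 (Or.inr (Or.inr ⟨he, h1, h2⟩)), hv⟩, ?_⟩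
            rintro e ⟨h, h'⟩
            have ho := old k l he h1 h2
            rcases (memA e).1 h with rfl | rfl | h
            · grind
            · grind
            · exact hu e h.1 h'
      noncrossing := by
        rintro ⟨k, l⟩ he ⟨k', l'⟩ he' ⟨h1, h2, h3⟩
        dsimp only at h1 h2 h3
        rcases (memA _).1 he with he | he | he <;> rcases (memA _).1 he' with he' | he' | he'
        · grind
        · grind
        -- An old arc leaving the new arc (i, t) would enclose t and start after i, against
        -- innermostness.
        · obtain ⟨rfl, rfl⟩ := Prod.mk.inj he
          have := hmax k' l' he'.1 h2 h3
          exact absurd h1 (not_lt.2 this)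
        · grind
        · grind
        · obtain ⟨rfl, rfl⟩ := Prod.mk.inj he
          exact b.noncrossing _ hij _ he'.1 ⟨(hit.trans htt').trans h1, h2, h3⟩
        · obtain ⟨rfl, rfl⟩ := Prod.mk.inj he'
          exact b.noncrossing _ he.1 _ hij ⟨h1, h2, h3.trans htj⟩
        · obtain ⟨rfl, rfl⟩ := Prod.mk.inj he'
          have ho := old k l he.1 he.2.1 he.2.2
          -- An old arc entering (t', j) from the left either encloses t, so by innermostness starts
          -- before i and crosses (i, j), or starts after t and crosses (t, t').
          rcases lt_or_gt_of_ne ho.2.2.1 with hk | hk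
          · have hki := hmax k l he.1 hk (htt'.trans h2)
            exact b.noncrossing _ he.1 _ hij
              ⟨lt_of_le_of_ne hki ho.1, (hit.trans htt').trans h2, h3⟩
          · exact b.noncrossing _ ht' _ he.1 ⟨hk, h1, h2⟩
        · exact b.noncrossing _ he.1 _ he'.1 ⟨h1, h2, h3⟩ }
  -- The words first differ at t, which turns from a left into a right endpoint; t' changes too, but
  -- later.
  refine ⟨a, lt_iff.2 ⟨t, fun s hs => ?_, ?_, ⟨t', ht'⟩⟩, fun e he => ?_⟩
  · constructor
    · rintro ⟨l, hl⟩
      rcases (memA _).1 hl with h | h | h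
      · exact (Prod.mk.inj h).1 ▸ ⟨j, hij⟩
      · exact absurd (Prod.mk.inj h).1 (hs.trans htt').ne
      · exact ⟨l, h.1⟩
    · rintro ⟨l, hl⟩
      by_cases h : s = i
      · exact ⟨t, (memA _).2 (Or.inl (by rw [h]))⟩
      · exact ⟨l, (memA _).2 (Or.inr (Or.inr ⟨hl, fun h' => h (Prod.mk.inj h').1,
          fun h' => hs.ne (Prod.mk.inj h').1⟩))⟩
  · exact not_isLeft_of_mem (i := i) ((memA _).2 (Or.inl rfl))
  · rcases (memA e).1 he with rfl | rfl | h
    · exact hxt.symm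
    · exact (hx _ ht').symm.trans (hxt.trans (hx _ hij))
    · exact hx e h.1

/-- The endpoints of an arc have opposite parity. -/
theorem even_iff_of_mem {i j : Fin n} (h : (i, j) ∈ a.arcs) :
    Even (i : ℕ) ↔ ¬ Even (j : ℕ) := by
  classical
  set A := a.arcs.filter fun e => i < e.1 ∧ e.2 < j with hA
  have hij : i < j := a.left_lt_right _ h
  have hun : Finset.Ioo i j = A.image Prod.fst ∪ A.image Prod.snd := by
    ext v
    simp only [hA, Finset.mem_Ioo, Finset.mem_union, Finset.mem_image, Finset.mem_filter]
    constructor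
    · rintro ⟨h1, h2⟩
      obtain ⟨e, ⟨he, hv⟩, -⟩ := a.perfect v
      have hlt := a.left_lt_right e he
      -- An arc with one end inside (i, j) shares no endpoint with it and does not cross it, so it
      -- lies inside entirely.
      have hin : i < e.1 ∧ e.2 < j := by
        have n1 := a.noncrossing _ h _ he
        have n2 := a.noncrossing _ he _ h
        have d1 : ∀ w, (e.1 = w ∨ e.2 = w) → ¬ (i = w ∨ j = w) := fun w hw hw' => by
          have := eq_of_endpoint he h hw hw'
          subst this
          grind
        have d2 := d1 e.1 (Or.inl rfl)
        have d3 := d1 e.2 (Or.inr rfl)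
        grind
      rcases hv with hv | hv
      · exact Or.inl ⟨e, ⟨he, hin⟩, hv⟩
      · exact Or.inr ⟨e, ⟨he, hin⟩, hv⟩
    · rintro (⟨e, ⟨he, h1, h2⟩, rfl⟩ | ⟨e, ⟨he, h1, h2⟩, rfl⟩)
      · exact ⟨h1, (a.left_lt_right e he).trans h2⟩
      · exact ⟨h1.trans (a.left_lt_right e he), h2⟩
  have hdisj : Disjoint (A.image Prod.fst) (A.image Prod.snd) := by
    rw [Finset.disjoint_left]
    intro v hv hv'
    obtain ⟨e, he, rfl⟩ := Finset.mem_image.1 hv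
    obtain ⟨e', he', he''⟩ := Finset.mem_image.1 hv'
    have hm := (Finset.mem_filter.1 he).1
    have hm' := (Finset.mem_filter.1 he').1
    have := eq_of_endpoint hm hm' (Or.inl rfl) (Or.inr he'')
    subst this
    exact (a.left_lt_right e hm).ne' he''
  have h1 : (A.image Prod.fst).card = A.card := Finset.card_image_of_injOn fun e he e' he' h =>
    eq_of_endpoint (Finset.mem_filter.1 he).1 (Finset.mem_filter.1 he').1 (Or.inl h) (Or.inl rfl)
  have h2 : (A.image Prod.snd).card = A.card := Finset.card_image_of_injOn fun e he e' he' h =>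
    eq_of_endpoint (Finset.mem_filter.1 he).1 (Finset.mem_filter.1 he').1 (Or.inr h) (Or.inr rfl)
  have hcard := congrArg Finset.card hun
  rw [Finset.card_union_of_disjoint hdisj, h1, h2, Fin.card_Ioo] at hcard
  have hij' : (i : ℕ) < j := hij
  have : (j : ℕ) = i + 2 * A.card + 1 := by omega
  rw [this]
  grind

end NoncrossingMatching

/-! ### Tubes around components and the induction over matchings -/

namespace NoncrossingMatching

variable {n : ℕ} (a : NoncrossingMatching n)

/-- The arc at a vertex. -/
def arcAt (v : Fin n) : Fin n × Fin n := (a.perfect v).choose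

/-- The left endpoint of the arc at a vertex. -/
def leftEnd (v : Fin n) : Fin n := (a.arcAt v).1

theorem arcAt_mem (v : Fin n) : a.arcAt v ∈ a.arcs := (a.perfect v).choose_spec.1.1

theorem arcAt_endpoint (v : Fin n) : (a.arcAt v).1 = v ∨ (a.arcAt v).2 = v :=
  (a.perfect v).choose_spec.1.2

variable {a}

theorem arcAt_fst {e : Fin n × Fin n} (he : e ∈ a.arcs) : a.arcAt e.1 = e :=
  eq_of_endpoint (a.arcAt_mem _) he (a.arcAt_endpoint _) (Or.inl rfl)

theorem arcAt_snd {e : Fin n × Fin n} (he : e ∈ a.arcs) : a.arcAt e.2 = e :=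
  eq_of_endpoint (a.arcAt_mem _) he (a.arcAt_endpoint _) (Or.inr rfl)

theorem leftEnd_eq_self {v : Fin n} (h : a.IsLeft v) : a.leftEnd v = v := by
  obtain ⟨j, hj⟩ := h
  exact congrArg Prod.fst (arcAt_fst hj)

theorem isLeft_leftEnd (v : Fin n) : a.IsLeft (a.leftEnd v) := ⟨_, a.arcAt_mem v⟩

theorem apply_leftEnd {x : Fin n → S2} (hx : x ∈ component a) (v : Fin n) :
    x (a.leftEnd v) = x v := by
  rcases a.arcAt_endpoint v with h | h
  · exact congrArg x h
  · exact (hx _ (a.arcAt_mem v)).trans (congrArg x h)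

theorem mem_component_of_arcAt {x : Fin n → S2}
    (h : ∀ v w, a.arcAt v = a.arcAt w → x v = x w) : x ∈ component a :=
  fun _ he => h _ _ ((arcAt_fst he).trans (arcAt_snd he).symm)

variable (a)

/-- The retraction of `(S²)ⁿ` to the component of a matching. -/
def collapse : C(Fin n → S2, Fin n → S2) := ⟨fun x v => x (a.leftEnd v), by fun_prop⟩

/-- A homotopy from the identity to the retraction. -/
def collapseHomotopy (s : ℝ) (x : Fin n → S2) : Fin n → S2 :=
  fun v => slide s (x v) (x (a.leftEnd v))

/-- An open neighbourhood of the component of a matching that retracts to it. -/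
def tubeSet : Set (Fin n → S2) := {x | ∀ v, -1 < sphereInner (x v) (x (a.leftEnd v))}

theorem isOpen_tubeSet : IsOpen (a.tubeSet) := by
  have : a.tubeSet = ⋂ v, {x | -1 < sphereInner (x v) (x (a.leftEnd v))} := by
    ext x
    simp [tubeSet]
  rw [this]
  exact isOpen_iInter_of_finite fun v => isOpen_lt continuous_const (by fun_prop)

variable {a}

theorem collapse_mem (x : Fin n → S2) : a.collapse x ∈ component a :=
  mem_component_of_arcAt fun _ _ h => congrArg (fun e : Fin n × Fin n => x e.1) h

theorem collapse_eq_self {x : Fin n → S2} (hx : x ∈ component a) : a.collapse x = x :=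
  funext fun v => apply_leftEnd hx v

theorem collapse_apply_of_isLeft {v : Fin n} (h : a.IsLeft v) (x : Fin n → S2) :
    a.collapse x v = x v := congrArg x (leftEnd_eq_self h)

theorem collapseHomotopy_zero (x : Fin n → S2) : a.collapseHomotopy 0 x = x :=
  funext fun _ => slide_zero _ _

theorem collapseHomotopy_one (x : Fin n → S2) : a.collapseHomotopy 1 x = a.collapse x :=
  funext fun _ => slide_one _ _

theorem collapseHomotopy_eq_self {x : Fin n → S2} (hx : x ∈ component a) (s : ℝ) :
    a.collapseHomotopy s x = x :=
  funext fun v => by rw [collapseHomotopy, apply_leftEnd hx, slide_self]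

theorem collapseHomotopy_mem_tubeSet {x : Fin n → S2} (hx : x ∈ a.tubeSet) (s : unitInterval) :
    a.collapseHomotopy s x ∈ a.tubeSet := by
  intro v
  have h : a.collapseHomotopy s x (a.leftEnd v) = x (a.leftEnd v) := by
    rw [collapseHomotopy, leftEnd_eq_self (isLeft_leftEnd v), slide_self]
  rw [h]
  exact (hx v).trans_le (le_sphereInner_slide s.2.1 s.2.2 (hx v))

theorem component_subset_tubeSet : component a ⊆ a.tubeSet := by
  intro x hx v
  rw [apply_leftEnd hx, sphereInner_self]
  norm_num

theorem continuous_collapseHomotopy {A : Set (Fin n → S2)} (hA : A ⊆ a.tubeSet) :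
    Continuous fun y : unitInterval × A => a.collapseHomotopy y.1 y.2.1 := by
  have hx : Continuous fun y : unitInterval × A => y.2.1 :=
    continuous_subtype_val.comp continuous_snd
  exact continuous_pi fun v => continuous_slide (continuous_subtype_val.comp continuous_fst)
    ((continuous_apply _).comp hx) ((continuous_apply _).comp hx)
    fun y => slideVec_ne_zero y.1.2.1 y.1.2.2 (hA y.2.2 v)

theorem isClosed_component : IsClosed (component a) := by
  have : component a = ⋂ e ∈ a.arcs, {x | x e.1 = x e.2} := by
    ext x
    simp [component]
  rw [this]
  exact isClosed_biInter fun e _ => isClosed_eq (continuous_apply _) (continuous_apply _)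

variable (n) in
/-- The part of the homology of `(S²)ⁿ` that comes from the components. -/
def componentSpan (m : ℕ) : Submodule ℂ (HomologyC m (Fin n → S2)) :=
  ⨆ a : NoncrossingMatching n, LinearMap.range (homologyCMap m (valMap (component a)))

/-- In (S²)ⁿ the inclusion of the tube is homotopic to the collapse, whose values lie in the
component. -/
theorem map_valMap_tubeSet_mem (m : ℕ) (z : HomologyC m a.tubeSet) :
    homologyCMap m (valMap a.tubeSet) z ∈ componentSpan n m := by
  have e : homologyCMap m (valMap a.tubeSet) = homologyCMap m ((valMap (component a)).comp
      ⟨fun x : a.tubeSet => ⟨a.collapse x, collapse_mem _⟩,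
        (a.collapse.continuous.comp continuous_subtype_val).subtype_mk _⟩) :=
    homologyCMap_eq_of_homotopy m (fun y => a.collapseHomotopy y.1 y.2.1)
      (continuous_collapseHomotopy subset_rfl) (fun x => collapseHomotopy_zero _)
      (fun x => collapseHomotopy_one _)
  rw [e, homologyCMap_comp]
  exact Submodule.mem_iSup_of_mem a ⟨_, rfl⟩

open Classical in
variable (a) in
/-- The left endpoint of the parent arc. -/
def parent (t : Fin n) : Fin n := if h : ∃ i, a.IsParent i t then h.choose else t

open Classical in
variable (a) in
/-- The left endpoints of arcs that have a parent. -/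
def children : Finset (Fin n) := Finset.univ.filter fun t => ∃ i, a.IsParent i t

theorem isParent_parent {t : Fin n} (ht : t ∈ a.children) : a.IsParent (a.parent t) t := by
  have h : ∃ i, a.IsParent i t := by simpa [children] using ht
  rw [parent, dif_pos h]
  exact h.choose_spec

theorem IsParent.mem_children {i t : Fin n} (h : a.IsParent i t) : t ∈ a.children := by
  simpa [children] using ⟨i, h⟩

theorem IsParent.parent_eq {i t : Fin n} (h : a.IsParent i t) : a.parent t = i :=
  (isParent_parent h.mem_children).unique h

theorem IsParent.isLeft {i t : Fin n} (h : a.IsParent i t) : a.IsLeft i := by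
  obtain ⟨-, -, ⟨j, hj, -⟩, -⟩ := h
  exact ⟨j, hj⟩

theorem collapse_mem_nearSet {c : ℝ} {x : Fin n → S2}
    (hx : x ∈ nearSet a.parent c a.children) : a.collapse x ∈ nearSet a.parent c a.children := by
  obtain ⟨t, ht, h⟩ := hx
  have hp := isParent_parent ht
  refine ⟨t, ht, ?_⟩
  rwa [collapse_apply_of_isLeft hp.1, collapse_apply_of_isLeft hp.isLeft]

/-- On the compact set S_b \ O no child coordinate equals its parent, since equality would put the
point in an earlier component and so in O. Each inner product therefore has a maximum below 1, and
any c < 1 above these maxima works. -/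
theorem exists_nearSet_inter_subset {b : NoncrossingMatching n} {O : Set (Fin n → S2)}
    (hO : IsOpen O) (h : ∀ a < b, component a ⊆ O) :
    ∃ c : ℝ, -1 ≤ c ∧ c < 1 ∧ nearSet b.parent c b.children ∩ component b ⊆ O := by
  have hK : IsCompact (component b \ O) := (isClosed_component.sdiff hO).isCompact
  have key : ∀ t ∈ b.children, ∀ᶠ c in nhdsWithin (1 : ℝ) (Set.Iio 1),
      ∀ x ∈ component b \ O, sphereInner (x t) (x (b.parent t)) ≤ c := by
    intro t ht
    have hcont : Continuous fun x : Fin n → S2 => sphereInner (x t) (x (b.parent t)) := by fun_prop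
    rcases (component b \ O).eq_empty_or_nonempty with hemp | hne
    · rw [hemp]
      exact Filter.Eventually.of_forall fun c x hx => hx.elim
    obtain ⟨x₀, hx₀, hmax⟩ := hK.exists_isMaxOn hne hcont.continuousOn
    have hlt : sphereInner (x₀ t) (x₀ (b.parent t)) < 1 := by
      refine lt_of_le_of_ne (sphereInner_le_one _ _) fun h1 => hx₀.2 ?_
      obtain ⟨a, hab, hxa⟩ := exists_lt_of_isParent (isParent_parent ht) hx₀.1
        (sphereInner_eq_one_iff.1 h1)
      exact h a hab hxa
    filter_upwards [Ico_mem_nhdsLT hlt] with c hc x hx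
    exact (hmax hx).trans hc.1
  obtain ⟨c, ⟨hc, hc1⟩, hc0⟩ := ((((Finset.eventually_all b.children).2 key).and
    self_mem_nhdsWithin).and (Ico_mem_nhdsLT (show (-1 : ℝ) < 1 by norm_num))).exists
  refine ⟨c, hc0.1, hc1, ?_⟩
  rintro x ⟨⟨t, ht, hlt⟩, hx⟩
  by_contra hxO
  exact absurd (hc t ht x ⟨hx, hxO⟩) (not_le.2 hlt)

/-- Projection along the compact interval is closed, so requiring the entire track of the homotopy
to stay in an open set is an open condition. -/
theorem isOpen_collapse_good {O N : Set (Fin n → S2)} (hO : IsOpen O) (hN : IsOpen N) :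
    IsOpen {x | x ∈ a.tubeSet ∧ (∀ s : unitInterval, a.collapseHomotopy s x ∈ O) ∧
      a.collapse x ∈ N} := by
  have h1 : IsOpen {x : a.tubeSet | ∀ s : unitInterval, a.collapseHomotopy s x ∈ O} := by
    have hcl := (isClosedMap_snd_of_compactSpace (X := unitInterval) (Y := a.tubeSet)) _
      (hO.isClosed_compl.preimage (continuous_collapseHomotopy (a := a) subset_rfl))
    convert hcl.isOpen_compl using 1
    ext x
    simp
  have h2 := (a.isOpen_tubeSet.isOpenMap_subtype_val _ h1).inter
    (hN.preimage a.collapse.continuous)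
  convert h2 using 1
  ext x
  simp only [Set.mem_ofPred_eq, Set.mem_inter_iff, Set.mem_image, Subtype.exists, Set.mem_preimage]
  constructor
  · rintro ⟨h, h', h''⟩
    exact ⟨⟨x, h, h', rfl⟩, h''⟩
  · rintro ⟨⟨y, h, h', rfl⟩, h''⟩
    exact ⟨h, h', h''⟩

/-- If `w` dies in `B`, it dies in the intersection of `O` with the tube. -/
theorem map_eq_zero_of_collapse {b : NoncrossingMatching n} {O A B : Set (Fin n → S2)} {c : ℝ}
    (hc : -1 ≤ c) (hc1 : c < 1) (hO : nearSet b.parent c b.children ∩ component b ⊆ O)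
    (hAO : A ∩ B ⊆ O ∩ b.tubeSet)
    (hQ : ∀ x ∈ A ∩ B, (∀ s : unitInterval, b.collapseHomotopy s x ∈ O) ∧
      b.collapse x ∈ nearSet b.parent c b.children)
    {m : ℕ} {w : HomologyC m ↥(A ∩ B)}
    (hw : homologyCMap m (setIncl Set.inter_subset_right) w = 0) :
    homologyCMap m (setIncl hAO) w = 0 := by
  let N := nearSet b.parent c b.children
  let f : C(↥(A ∩ B), N) := ⟨fun x => ⟨b.collapse x, (hQ x x.2).2⟩,
    (b.collapse.continuous.comp continuous_subtype_val).subtype_mk _⟩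
  -- N is open in (S²)ⁿ and need not lie in S_b, so a second collapse returns to N ∩ S_b ⊆ O. As the
  -- collapse is idempotent, g ∘ f is just the collapse, the end of the homotopy.
  let g : C(N, ↥(O ∩ b.tubeSet)) := ⟨fun x => ⟨b.collapse x,
    hO ⟨collapse_mem_nearSet x.2, collapse_mem _⟩, component_subset_tubeSet (collapse_mem _)⟩,
    (b.collapse.continuous.comp continuous_subtype_val).subtype_mk _⟩
  have e : homologyCMap m (setIncl hAO) = homologyCMap m (g.comp f) :=
    homologyCMap_eq_of_homotopy m
      (fun y => ⟨b.collapseHomotopy y.1 y.2.1, (hQ _ y.2.2).1 y.1,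
        collapseHomotopy_mem_tubeSet (hAO y.2.2).2 y.1⟩)
      ((continuous_collapseHomotopy (hAO.trans Set.inter_subset_right)).subtype_mk _)
      (fun x => Subtype.ext (collapseHomotopy_zero _))
      (fun x => Subtype.ext ((collapseHomotopy_one _).trans
        (collapse_eq_self (collapse_mem _)).symm))
  -- In (S²)ⁿ the image of f_* w is the collapse of the image of w, which is zero because w already
  -- dies in B. The forest lemma lifts this vanishing to N.
  have hf : homologyCMap m f w = 0 := by
    apply homologyCMap_valMap_nearSet_injective b.parent hc hc1 b.children
      fun t ht => (isParent_parent ht).2.1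
    rw [map_zero, homologyCMap_eq_of_comp_eq m (f := f) (g := valMap N)
      (f' := setIncl Set.inter_subset_right) (g' := b.collapse.comp (valMap B)) rfl, hw, map_zero]
  rw [e, homologyCMap_comp, hf, map_zero]

theorem exists_open_nhds (s : Finset (NoncrossingMatching n))
    (hs : ∀ a ∈ s, ∀ b < a, b ∈ s) :
    ∃ O : Set (Fin n → S2), IsOpen O ∧ (∀ a ∈ s, component a ⊆ O) ∧
      ∀ m (z : HomologyC m O), homologyCMap m (valMap O) z ∈ componentSpan n m := by
  classical
  induction s using Finset.induction_on_max with
  | empty =>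
    refine ⟨∅, isOpen_empty, by simp, fun m z => ?_⟩
    rw [homologyC_eq_zero_of_isEmpty m z, map_zero]
    exact zero_mem _
  | insert b s hb ih =>
    have hs' : ∀ a < b, a ∈ s := fun a hab =>
      (Finset.mem_insert.1 (hs b (Finset.mem_insert_self _ _) a hab)).resolve_left hab.ne
    obtain ⟨O, hO, hsO, hOm⟩ := ih fun a ha c hca => hs' c (hca.trans (hb a ha))
    obtain ⟨c, hc, hc1, hcO⟩ := exists_nearSet_inter_subset hO fun a hab => hsO a (hs' a hab)
    set N := nearSet b.parent c b.children
    set Q := {x | x ∈ b.tubeSet ∧ (∀ s : unitInterval, b.collapseHomotopy s x ∈ O) ∧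
      b.collapse x ∈ N}
    have hQ : IsOpen Q := isOpen_collapse_good hO (isOpen_nearSet _ _ _)
    set F := ⋃ a ∈ s, component a
    have hF : IsClosed F := isClosed_biUnion_finset fun a _ => isClosed_component
    -- Points of S_b are fixed throughout the homotopy, and those in an earlier component lie on a
    -- parent diagonal.
    have hFQ : F ∩ component b ⊆ Q := by
      rintro x ⟨hxF, hxb⟩
      obtain ⟨a, ha, hxa⟩ := Set.mem_iUnion₂.1 hxF
      refine ⟨component_subset_tubeSet hxb, fun s => ?_, ?_⟩
      · rw [collapseHomotopy_eq_self hxb]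
        exact hsO a ha hxa
      · rw [collapse_eq_self hxb]
        obtain ⟨i, t, hit, hx⟩ := exists_parent_eq (hb a ha) hxa
        refine ⟨t, hit.mem_children, ?_⟩
        rwa [hit.parent_eq, hx, sphereInner_self]
    -- Separating the two closed sets outside Q forces the neighbourhoods A and B of the two unions
    -- to overlap only in Q, where the collapse is under control.
    obtain ⟨U, V, hU, hV, hFU, hbV, hUV⟩ := normal_separation (hF.sdiff hQ)
      (isClosed_component.sdiff hQ) (Set.disjoint_left.2 fun x hx hx' =>
        hx.2 (hFQ ⟨hx.1, hx'.1⟩))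
    set A := (U ∪ Q) ∩ O
    set B := (V ∪ Q) ∩ b.tubeSet
    have hA : IsOpen A := (hU.union hQ).inter hO
    have hB : IsOpen B := (hV.union hQ).inter b.isOpen_tubeSet
    have hAB : A ∩ B ⊆ Q := by
      rintro x ⟨⟨h1 | h1, -⟩, h2 | h2, -⟩
      · exact absurd h2 (Set.disjoint_left.1 hUV h1)
      all_goals assumption
    refine ⟨A ∪ B, hA.union hB, fun a ha x hx => ?_, fun m z => ?_⟩
    · by_cases hxQ : x ∈ Q
      · exact Or.inr ⟨Or.inr hxQ, hxQ.1⟩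
      rcases Finset.mem_insert.1 ha with rfl | ha
      · exact Or.inr ⟨Or.inl (hbV ⟨hx, hxQ⟩), component_subset_tubeSet hx⟩
      · exact Or.inl ⟨Or.inl (hFU ⟨Set.mem_iUnion₂.2 ⟨a, ha, hx⟩, hxQ⟩), hsO a ha hx⟩
    · have hAO : A ⊆ O := Set.inter_subset_right
      have hBT : B ⊆ b.tubeSet := Set.inter_subset_right
      have hval := homologyCMap_valMap_setIncl m (Set.union_subset_union hAO hBT) z
      obtain ⟨u, v, huv⟩ : ∃ (u : HomologyC m O) (v : HomologyC m b.tubeSet),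
          homologyCMap m (setIncl (Set.union_subset_union hAO hBT)) z =
            homologyCMap m (setIncl Set.subset_union_left) u +
              homologyCMap m (setIncl Set.subset_union_right) v := by
        cases m with
        | zero => exact exists_add_of_degree_zero hO b.isOpen_tubeSet _
        | succ k =>
          obtain ⟨w, hw⟩ := exists_mvRel hA hB z
          have hw' := hw.mono hAO hBT
          -- The boundary need not vanish for the pair (A, B); it vanishes after enlarging to O and
          -- the tube, which suffices to split the image of z.
          rw [map_eq_zero_of_collapse hc hc1 hcO (Set.inter_subset_inter hAO hBT)
            (fun x hx => (hAB hx).2) hw.map_right_eq_zero] at hw'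
          exact hw'.exists_add
      rw [← hval, huv, map_add, homologyCMap_valMap_setIncl, homologyCMap_valMap_setIncl]
      exact add_mem (hOm m u) (map_valMap_tubeSet_mem m v)

/-- The homology classes of `(S²)ⁿ` that come from the Springer variety come from its
components. -/
theorem map_valMap_springerVariety_mem (m : ℕ) (z : HomologyC m (springerVariety n)) :
    homologyCMap m (valMap (springerVariety n)) z ∈ componentSpan n m := by
  classical
  have := Fintype.ofFinite (NoncrossingMatching n)
  obtain ⟨O, -, hO, h⟩ := exists_open_nhds (Finset.univ : Finset (NoncrossingMatching n))
    fun _ _ _ _ => Finset.mem_univ _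
  have hsub : springerVariety n ⊆ O := Set.iUnion_subset fun a => hO a (Finset.mem_univ a)
  rw [← homologyCMap_valMap_setIncl m hsub]
  exact h m _

end NoncrossingMatching

/-! ### Total homology, flips and signs -/

theorem totalHomologyCMap_lof {X Y : Type} [TopologicalSpace X] [TopologicalSpace Y] (f : C(X, Y))
    (k : ℕ) (h : HomologyC k X) :
    totalHomologyCMap f (DirectSum.lof ℂ ℕ (fun k => HomologyC k X) k h) =
      DirectSum.lof ℂ ℕ (fun k => HomologyC k Y) k (homologyCMap k f h) :=
  DirectSum.lmap_lof _ _ _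

theorem totalHomologyCMap_comp {X Y Z : Type} [TopologicalSpace X] [TopologicalSpace Y]
    [TopologicalSpace Z] (g : C(Y, Z)) (f : C(X, Y)) (x : TotalHomologyC X) :
    totalHomologyCMap (g.comp f) x = totalHomologyCMap g (totalHomologyCMap f x) := by
  suffices h : totalHomologyCMap (g.comp f) = totalHomologyCMap g ∘ₗ totalHomologyCMap f from
    LinearMap.congr_fun h x
  refine DirectSum.linearMap_ext ℂ fun k => LinearMap.ext fun h => ?_
  simp only [LinearMap.comp_apply, totalHomologyCMap_lof, homologyCMap_comp]

theorem exists_path_neg (p : S2) : ∃ γ : C(unitInterval, S2), γ 0 = p ∧ γ 1 = -p := by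
  have hrank : 1 < Module.rank ℝ (EuclideanSpace ℝ (Fin 3)) := by
    rw [← Module.finrank_eq_rank, finrank_euclideanSpace_fin]
    norm_num
  have := isPathConnected_iff_pathConnectedSpace.1
    (isPathConnected_sphere hrank (0 : EuclideanSpace ℝ (Fin 3)) zero_le_one)
  let γ := PathConnectedSpace.somePath p (-p)
  exact ⟨γ.toContinuousMap, γ.source, γ.target⟩

namespace NoncrossingMatching

variable {n : ℕ} (a : NoncrossingMatching n)

/-- The arc at `v` is one on which the two antipodal embeddings differ. -/
def IsFlipped (v : Fin n) : Prop := ¬ Odd ((a.leftEnd v : ℕ) + 1)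

open Classical in
/-- The involution of a component that relates the two antipodal embeddings. -/
def flip : C(component a, component a) where
  toFun x := ⟨fun v => if a.IsFlipped v then -x.1 v else x.1 v, fun e he => by
    have h : a.IsFlipped e.1 ↔ a.IsFlipped e.2 := by
      rw [IsFlipped, IsFlipped, leftEnd, leftEnd, arcAt_fst he, arcAt_snd he]
    simp only [h, x.2 e he]⟩
  continuous_toFun := by
    refine Continuous.subtype_mk (continuous_pi fun v => ?_) _
    have hv : Continuous fun x : component a => x.1 v :=
      (continuous_apply v).comp continuous_subtype_val
    split_ifs
    exacts [hv.neg, hv]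

variable {a}

theorem flip_apply_of_isFlipped (x : component a) {v : Fin n} (h : a.IsFlipped v) :
    (a.flip x).1 v = -x.1 v := if_pos h

theorem flip_apply_of_not_isFlipped (x : component a) {v : Fin n} (h : ¬ a.IsFlipped v) :
    (a.flip x).1 v = x.1 v := if_neg h

theorem flip_flip (x : component a) : a.flip (a.flip x) = x := by
  refine Subtype.ext (funext fun v => ?_)
  by_cases h : a.IsFlipped v
  · rw [flip_apply_of_isFlipped _ h, flip_apply_of_isFlipped _ h, neg_neg]
  · rw [flip_apply_of_not_isFlipped _ h, flip_apply_of_not_isFlipped _ h]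

theorem isFlipped_iff_of_isLeft {v : Fin n} (h : a.IsLeft v) :
    a.IsFlipped v ↔ ¬ Odd ((v : ℕ) + 1) := by
  rw [IsFlipped, leftEnd_eq_self h]

/-- Opposite parity of the two ends of an arc turns the condition at the left end into one at the
right end. This makes the flip well defined on arcs and still compatible with the signs of γ. -/
theorem isFlipped_iff_of_not_isLeft {v : Fin n} (h : ¬ a.IsLeft v) :
    a.IsFlipped v ↔ Odd ((v : ℕ) + 1) := by
  obtain ⟨i, hi⟩ := exists_left_of_not_isLeft h
  have h1 : a.leftEnd v = i := congrArg Prod.fst (arcAt_snd hi)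
  have h2 := even_iff_of_mem hi
  rw [IsFlipped, h1]
  grind

theorem gammaComponent_apply_of_isLeft (x : component a) {v : Fin n} (h : a.IsLeft v) :
    gammaComponent a x v = -x.1 v := if_pos h

theorem gammaComponent_apply_of_not_isLeft (x : component a) {v : Fin n} (h : ¬ a.IsLeft v) :
    gammaComponent a x v = x.1 v := if_neg h

theorem gammaRestrict_apply_of_odd (x : component a) {v : Fin n} (h : Odd ((v : ℕ) + 1)) :
    gammaRestrict a x v = -x.1 v := if_pos h

theorem gammaRestrict_apply_of_not_odd (x : component a) {v : Fin n} (h : ¬ Odd ((v : ℕ) + 1)) :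
    gammaRestrict a x v = x.1 v := if_neg h

theorem gammaComponent_comp_flip : (gammaComponent a).comp a.flip = gammaRestrict a := by
  refine ContinuousMap.ext fun x => funext fun v => ?_
  rw [ContinuousMap.comp_apply]
  by_cases hv : a.IsLeft v
  · rw [gammaComponent_apply_of_isLeft _ hv]
    by_cases ho : Odd ((v : ℕ) + 1)
    · rw [gammaRestrict_apply_of_odd _ ho, flip_apply_of_not_isFlipped]
      rw [isFlipped_iff_of_isLeft hv]
      exact not_not.2 ho
    · rw [gammaRestrict_apply_of_not_odd _ ho,
        flip_apply_of_isFlipped _ ((isFlipped_iff_of_isLeft hv).2 ho), neg_neg]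
  · rw [gammaComponent_apply_of_not_isLeft _ hv]
    by_cases ho : Odd ((v : ℕ) + 1)
    · rw [gammaRestrict_apply_of_odd _ ho,
        flip_apply_of_isFlipped _ ((isFlipped_iff_of_not_isLeft hv).2 ho)]
    · rw [gammaRestrict_apply_of_not_odd _ ho, flip_apply_of_not_isFlipped]
      rwa [isFlipped_iff_of_not_isLeft hv]

theorem gammaRestrict_comp_flip : (gammaRestrict a).comp a.flip = gammaComponent a := by
  rw [← gammaComponent_comp_flip, ContinuousMap.comp_assoc]
  exact ContinuousMap.ext fun x => congrArg (gammaComponent a) (flip_flip x)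

section ClosedCell

variable {p : S2} {D : Finset (Fin n × Fin n)}

theorem closedCell_apply (x : closedCell p a D) {v : Fin n}
    (hv : a.arcAt v ∈ D) : x.1.1 v = p := by
  rcases a.arcAt_endpoint v with h | h
  · rw [← h]
    exact (x.2 _ hv).1
  · rw [← h]
    exact (x.2 _ hv).2

theorem mem_closedCell (hD : D ⊆ a.arcs) {x : component a} (h : ∀ v, a.arcAt v ∈ D → x.1 v = p) :
    x ∈ closedCell p a D := fun _ he =>
  ⟨h _ ((arcAt_fst (hD he)).symm ▸ he), h _ ((arcAt_snd (hD he)).symm ▸ he)⟩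

open Classical in
/-- The involution of a closed cell that negates the undotted flipped arcs. -/
def cellFlip (hD : D ⊆ a.arcs) : C(closedCell p a D, closedCell p a D) where
  toFun x := ⟨⟨fun v => if a.IsFlipped v ∧ a.arcAt v ∉ D then -x.1.1 v else x.1.1 v,
    mem_component_of_arcAt fun v w h => by
      have hx : x.1.1 v = x.1.1 w := by
        rw [← apply_leftEnd x.1.2 v, ← apply_leftEnd x.1.2 w, leftEnd, leftEnd, h]
      rw [IsFlipped, IsFlipped, leftEnd, leftEnd, h, hx]⟩,
    mem_closedCell hD fun v hv =>
      (if_neg fun h => h.2 hv).trans (closedCell_apply x hv)⟩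
  continuous_toFun := by
    refine Continuous.subtype_mk (Continuous.subtype_mk (continuous_pi fun v => ?_) _) _
    have hv : Continuous fun x : closedCell p a D => x.1.1 v :=
      (continuous_apply v).comp (continuous_subtype_val.comp continuous_subtype_val)
    split_ifs
    exacts [hv.neg, hv]

theorem cellFlip_apply_of_pos (hD : D ⊆ a.arcs) (x : closedCell p a D) {v : Fin n}
    (h : a.IsFlipped v ∧ a.arcAt v ∉ D) : (cellFlip hD x).1.1 v = -x.1.1 v := if_pos h

theorem cellFlip_apply_of_neg (hD : D ⊆ a.arcs) (x : closedCell p a D) {v : Fin n}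
    (h : ¬ (a.IsFlipped v ∧ a.arcAt v ∉ D)) : (cellFlip hD x).1.1 v = x.1.1 v := if_neg h

theorem cellFlip_involutive (hD : D ⊆ a.arcs) :
    Function.Involutive (cellFlip (p := p) hD) := by
  intro x
  refine Subtype.ext (Subtype.ext (funext fun v => ?_))
  by_cases h : a.IsFlipped v ∧ a.arcAt v ∉ D
  · rw [cellFlip_apply_of_pos _ _ h, cellFlip_apply_of_pos _ _ h, neg_neg]
  · rw [cellFlip_apply_of_neg _ _ h, cellFlip_apply_of_neg _ _ h]

open Classical in
/-- A homotopy from the flip of the closed cell to the flip of the component. -/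
def cellHomotopy (D : Finset (Fin n × Fin n)) (γ : C(unitInterval, S2)) (s : unitInterval)
    (x : component a) : component a :=
  ⟨fun v => if a.IsFlipped v then (if a.arcAt v ∈ D then γ s else -x.1 v) else x.1 v,
    mem_component_of_arcAt fun v w h => by
      have hx : x.1 v = x.1 w := by
        rw [← apply_leftEnd x.2 v, ← apply_leftEnd x.2 w, leftEnd, leftEnd, h]
      rw [IsFlipped, IsFlipped, leftEnd, leftEnd, h, hx]⟩

theorem continuous_cellHomotopy (γ : C(unitInterval, S2)) :
    Continuous fun y : unitInterval × closedCell p a D => cellHomotopy D γ y.1 y.2.1 := by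
  refine Continuous.subtype_mk (continuous_pi fun v => ?_) _
  have hv : Continuous fun y : unitInterval × closedCell p a D => y.2.1.1 v :=
    (continuous_apply v).comp (continuous_subtype_val.comp
      (continuous_subtype_val.comp continuous_snd))
  split_ifs
  exacts [γ.continuous.comp continuous_fst, hv.neg, hv]

open Classical in
-- The flip moves the closed cell off itself by sending p to -p on the dotted flipped arcs. A path
-- from p to -p moves it back inside S_a.
theorem homologyCMap_flip_comp_valMap (hD : D ⊆ a.arcs) (k : ℕ) :
    homologyCMap k ((valMap (closedCell p a D)).comp (cellFlip hD)) =
      homologyCMap k (a.flip.comp (valMap (closedCell p a D))) := by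
  obtain ⟨γ, h0, h1⟩ := exists_path_neg p
  refine homologyCMap_eq_of_homotopy k _ (continuous_cellHomotopy γ) (fun x => ?_) fun x => ?_
  · refine Subtype.ext (funext fun v => ?_)
    change (if a.IsFlipped v then (if a.arcAt v ∈ D then γ 0 else -x.1.1 v) else x.1.1 v) =
      (cellFlip hD x).1.1 v
    by_cases hv : a.IsFlipped v
    · by_cases hd : a.arcAt v ∈ D
      · rw [if_pos hv, if_pos hd, h0, cellFlip_apply_of_neg _ _ fun h => h.2 hd,
          closedCell_apply x hd]
      · rw [if_pos hv, if_neg hd, cellFlip_apply_of_pos _ _ ⟨hv, hd⟩]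
    · rw [if_neg hv, cellFlip_apply_of_neg _ _ fun h => hv h.1]
  · refine Subtype.ext (funext fun v => ?_)
    change (if a.IsFlipped v then (if a.arcAt v ∈ D then γ 1 else -x.1.1 v) else x.1.1 v) =
      (a.flip x.1).1 v
    by_cases hv : a.IsFlipped v
    · rw [if_pos hv, flip_apply_of_isFlipped _ hv]
      by_cases hd : a.arcAt v ∈ D
      · rw [if_pos hd, h1, closedCell_apply x hd]
      · rw [if_neg hd]
    · rw [if_neg hv, flip_apply_of_not_isFlipped _ hv]

open Classical in
-- The coordinates at the undotted arcs determine a point of the cell. That `g` is a left inverse of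
-- `f` suffices to carry the dimension bound from the power of S².
theorem homologyDependent_closedCell (hD : D ⊆ a.arcs) :
    HomologyDependent (2 * (a.arcs \ D).card) (closedCell p a D) := by
  let e : Fin (a.arcs \ D).card ≃ ↥(a.arcs \ D) := (a.arcs \ D).equivFin.symm
  let f : C(closedCell p a D, Fin (a.arcs \ D).card → S2) :=
    ⟨fun x j => x.1.1 (e j).1.1, continuous_pi fun j => (continuous_apply _).comp
      (continuous_subtype_val.comp continuous_subtype_val)⟩
  let g : C(Fin (a.arcs \ D).card → S2, closedCell p a D) :=
    ⟨fun y => ⟨⟨fun v => if h : a.arcAt v ∈ D then p else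
        y (e.symm ⟨a.arcAt v, Finset.mem_sdiff.2 ⟨a.arcAt_mem v, h⟩⟩),
        mem_component_of_arcAt fun v w h => by simp only [h]⟩,
      mem_closedCell hD fun v hv => dif_pos hv⟩, by
      refine Continuous.subtype_mk (Continuous.subtype_mk (continuous_pi fun v => ?_) _) _
      split_ifs
      exacts [continuous_const, continuous_apply _]⟩
  refine (homologyDependent_sphere_pow _).of_injective
    (homologyCMap_injective_of_leftInverse (f := f) (g := g) fun x => ?_)
  refine Subtype.ext (Subtype.ext (funext fun v => ?_))
  change (if h : a.arcAt v ∈ D then p else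
    x.1.1 (e (e.symm ⟨a.arcAt v, Finset.mem_sdiff.2 ⟨a.arcAt_mem v, h⟩⟩)).1.1) = x.1.1 v
  split_ifs with h
  · exact (closedCell_apply x h).symm
  · rw [Equiv.apply_symm_apply]
    exact apply_leftEnd x.1.2 v

/-- Since γ|S_a = γ_a ∘ `flip`, the sign is the one by which `cellFlip` acts on the top homology of
the closed cell. -/
theorem exists_sign_gammaRestrict (hD : D ⊆ a.arcs) :
    ∃ ε : ℂ, (ε = 1 ∨ ε = -1) ∧ ∀ q ∈ generatorLine p a D,
      totalHomologyCMap (gammaRestrict a) q = ε • totalHomologyCMap (gammaComponent a) q := by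
  obtain ⟨ε, hε, hsign⟩ := (homologyDependent_closedCell (p := p) hD).exists_sign
    (cellFlip_involutive hD)
  refine ⟨ε, hε, ?_⟩
  rintro _ ⟨_, ⟨h, rfl⟩, rfl⟩
  rw [totalHomologyCMap_lof, totalHomologyCMap_lof, ← map_smul]
  congr 1
  change homologyCMap _ _ (homologyCMap _ (valMap (closedCell p a D)) h) =
    ε • homologyCMap _ _ (homologyCMap _ (valMap (closedCell p a D)) h)
  rw [← gammaComponent_comp_flip, homologyCMap_comp, ← homologyCMap_comp _ a.flip,
    ← homologyCMap_flip_comp_valMap hD, homologyCMap_comp _ (valMap _), hsign, map_smul, map_smul]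

end ClosedCell

/-! ### The image of γ on homology -/

variable (n)

open Classical in
/-- The extension of the antipodal embedding of the Springer variety to `(S²)ⁿ`. -/
def gammaExtend : C(Fin n → S2, Fin n → S2) := negOn {i : Fin n | Odd ((i : ℕ) + 1)}

theorem gammaExtend_comp_valMap :
    (gammaExtend n).comp (valMap (springerVariety n)) = gammaMap n := rfl

theorem gammaExtend_comp_valMap_component (a : NoncrossingMatching n) :
    (gammaExtend n).comp (valMap (component a)) = gammaRestrict a := rfl

theorem range_gammaMap :
    LinearMap.range (totalHomologyCMap (gammaMap n)) =
      Submodule.span ℂ (⋃ a : NoncrossingMatching n,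
        (LinearMap.range (totalHomologyCMap (gammaComponent a)) :
          Set (TotalHomologyC (Fin n → S2)))) := by
  set S := Submodule.span ℂ (⋃ a : NoncrossingMatching n,
    (LinearMap.range (totalHomologyCMap (gammaComponent a)) :
      Set (TotalHomologyC (Fin n → S2))))
  apply le_antisymm
  -- It suffices to treat classes that come from the components, and there γ is γ_a after the flip.
  · have hle : ∀ k, componentSpan n k ≤ S.comap
        (DirectSum.lof ℂ ℕ (fun k => HomologyC k (Fin n → S2)) k ∘ₗ
          homologyCMap k (gammaExtend n)) := by
      intro k
      refine iSup_le fun a => ?_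
      rintro _ ⟨h, rfl⟩
      refine Submodule.subset_span (Set.mem_iUnion.2 ⟨a,
        DirectSum.lof ℂ ℕ (fun k => HomologyC k (component a)) k (homologyCMap k a.flip h), ?_⟩)
      rw [totalHomologyCMap_lof, ← homologyCMap_comp, gammaComponent_comp_flip,
        LinearMap.comp_apply, ← homologyCMap_comp, gammaExtend_comp_valMap_component]
    rintro _ ⟨x, rfl⟩
    induction x using DirectSum.induction_on with
    | zero => rw [map_zero]; exact zero_mem _
    | add x y hx hy => rw [map_add]; exact add_mem hx hy
    | of k h =>
      have := hle k (map_valMap_springerVariety_mem k h)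
      rw [Submodule.mem_comap, LinearMap.comp_apply, ← homologyCMap_comp,
        gammaExtend_comp_valMap, ← totalHomologyCMap_lof] at this
      exact this
  · refine Submodule.span_le.2 (Set.iUnion_subset fun a => ?_)
    rintro _ ⟨x, rfl⟩
    -- Conversely γ_a = γ|S_a ∘ `flip`, so the flipped class, included in X_n, is a preimage.
    refine ⟨totalHomologyCMap ((setIncl (component_subset_springerVariety a)).comp a.flip) x, ?_⟩
    rw [← totalHomologyCMap_comp, ← gammaRestrict_comp_flip]
    rfl

end NoncrossingMatching

end

theorem mainTheorem7 (n : ℕ) (hn : Even n) :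
    LinearMap.range (totalHomologyCMap (gammaMap n)) =
        Submodule.span ℂ (⋃ a : NoncrossingMatching n,
          (LinearMap.range (totalHomologyCMap (gammaComponent a)) :
            Set (TotalHomologyC (Fin n → S2)))) ∧
      ∀ (p : S2) (a : NoncrossingMatching n) (D : Finset (Fin n × Fin n)), D ⊆ a.arcs →
        ∃ ε : ℂ, (ε = 1 ∨ ε = -1) ∧ ∀ q ∈ generatorLine p a D,
          totalHomologyCMap (gammaRestrict a) q = ε • totalHomologyCMap (gammaComponent a) q :=
  ⟨NoncrossingMatching.range_gammaMap n, fun _ _ _ hD =>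
    NoncrossingMatching.exists_sign_gammaRestrict hD⟩
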